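/- Let $\xi$ and $\eta$ be independent real-valued compound Poisson processes, i.e. L\'evy processes without Gaussian part and drift whose L\'evy measures $\nu_\xi,\nu_\eta$ are finite and nonzero with $\nu_\xi(\{0\})=\nu_\eta(\{0\})=0$. Let $q\in(0,\infty)$, let $\tau$ be exponentially distributed with parameter $q$ and independent of $(\xi,\eta)$, and let $$V=\int_0^\tau e^{-\xi_{s-}}\,d\eta_s$$ be the killed exponential functional. Write $\operatorname{supp}$ for the support of a measure, or of the law of a random variable, $\mathbb R_+=[0,\infty)$ and $\mathbb R_-=(-\infty,0]$. Assume that $0\notin\operatorname{supp}\nu_\eta$, $0\notin\operatorname{supp}\nu_\xi$ and $\nu_\xi(\mathbb R_+)=0$. A subordinator is a L\'evy process with a.s. nondecreasing paths. Then the following hold. (i) If $\beta<\alpha<0$ and $[\beta,\alpha]\subseteq\operatorname{supp}\nu_\xi$, then with $k=\lfloor\frac{\alpha}{\beta-\alpha}\rfloor+1$, $$\operatorname{supp}V\supseteq\begin{cases}\operatorname{supp}(\eta_\tau)\cup[e^{-k\alpha}\inf\operatorname{supp}\nu_\eta,\infty),&\text{if }\eta\text{ is a subordinator},\\ \operatorname{supp}(\eta_\tau)\cup(-\infty,e^{-k\alpha}\sup\operatorname{supp}\nu_\eta],&\text{if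 }-\eta\text{ is a subordinator},\\ \mathbb R,&\text{otherwise.}\end{cases}$$ (ii) If $\eta$ is a subordinator, $0<\alpha<\beta$ and $[\alpha,\beta]\subseteq\operatorname{supp}\nu_\eta$, then with $k=\lfloor\frac{\alpha}{\beta-\alpha}\rfloor+1$, $$\operatorname{supp}V\supseteq\begin{cases}\{0\}\cup[\alpha,\infty),&\text{if }\ln(\beta/\alpha)\ge-\sup\operatorname{supp}\nu_\xi,\\ \{0\}\cup\bigcup_{\ell=1}^{k-1}[\ell\alpha,\ell\beta]\cup[k\alpha,\infty),&\text{otherwise.}\end{cases}$$ (iii) If $-\eta$ is a subordinator, $\beta<\alpha<0$ and $[\beta,\alpha]\subseteq\operatorname{supp}\nu_\eta$, then with $k=\lfloor\frac{\alpha}{\beta-\alpha}\rfloor+1$, $$\operatorname{supp}V\supseteq\begin{cases}(-\infty,\alpha]\cup\{0\},&\text{if }\ln(\beta/\alpha)\ge-\sup\operatorname{supp}\nu_\xi,\\ (-\infty,k\alpha]\cup\bigcup_{\ell=1}^{k-1}[\ell\beta,\ell\alpha]\cup\{0\},&\text{otherwise.}\end{cases}$$ (iv) If $\nu_\eta(\mathbb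 R_-)\ne0\ne\nu_\eta(\mathbb R_+)$ and there are $0<\alpha<\beta$ with $[\alpha,\beta]\subseteq\operatorname{supp}\nu_\eta$ or $\beta<\alpha<0$ with $[\beta,\alpha]\subseteq\operatorname{supp}\nu_\eta$, then $\operatorname{supp}V=\mathbb R$. (v) If there are $z_1<0<z_2$ in $\operatorname{supp}\nu_\eta$ such that $z_2/z_1$ is irrational, then $\operatorname{supp}V=\mathbb R$. -/

import Mathlib

open MeasureTheory ProbabilityTheory Filter
open scoped NNReal Topology

namespace KilledExp

/-- Càdlàg paths: right-continuous with finite left limits. -/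
def IsCadlag (f : ℝ≥0 → ℝ) : Prop :=
  ∀ t, ContinuousWithinAt f (Set.Ici t) t ∧ ∃ l, Tendsto f (𝓝[<] t) (𝓝 l)

/-- A real-valued Lévy process: starts in `0`, has independent and stationary increments, and
almost surely has càdlàg paths. -/
structure IsLevyProcess {Ω : Type*} [MeasurableSpace Ω] (X : ℝ≥0 → Ω → ℝ) (P : Measure Ω) :
    Prop where
  measurable : ∀ t, Measurable (X t)
  start_zero : ∀ᵐ ω ∂P, X 0 ω = 0
  indep_increments : HasIndepIncrements X P
  stationary_increments : ∀ s h : ℝ≥0, IdentDistrib (fun ω ↦ X (s + h) ω - X s ω) (X h) P P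
  cadlag : ∀ᵐ ω ∂P, IsCadlag (fun t ↦ X t ω)

/-- A subordinator: a Lévy process with almost surely nondecreasing paths. -/
structure IsSubordinator {Ω : Type*} [MeasurableSpace Ω] (X : ℝ≥0 → Ω → ℝ) (P : Measure Ω) :
    Prop where
  isLevy : IsLevyProcess X P
  monotone : ∀ᵐ ω ∂P, Monotone (fun t ↦ X t ω)

/-- A compound Poisson process with Lévy measure `ν`: a Lévy process with no Gaussian part and no
drift, whose Lévy measure `ν` is finite and nonzero (and, by convention, does not charge `0`). Its
jump rate is `ν(ℝ)`, its jump distribution is `ν / ν(ℝ)`, and its characteristic function is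
`E exp(i z X_t) = exp (t ∫ (exp(i z x) - 1) ν(dx))`. -/
structure IsCompoundPoisson {Ω : Type*} [MeasurableSpace Ω] (X : ℝ≥0 → Ω → ℝ) (ν : Measure ℝ)
    (P : Measure Ω) : Prop where
  isLevy : IsLevyProcess X P
  finite : IsFiniteMeasure ν
  ne_zero : ν ≠ 0
  zero_null : ν {0} = 0
  charFun_eq : ∀ (t : ℝ≥0) (z : ℝ), charFun (P.map (X t)) z =
    Complex.exp ((t : ℂ) * ∫ x : ℝ, (Complex.exp ((z : ℂ) * (x : ℂ) * Complex.I) - 1) ∂ν)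

/-- The integral `∫_0^t exp (-f(s-)) dg(s)` of the left limits of `exp (-f)` against a càdlàg pure
jump path `g`, that is, the sum of `exp (-f(s-)) * (g(s) - g(s-))` over `0 < s ≤ t`. Almost every
path of a compound Poisson process is a step function with finitely many jumps in `(0, t]`; for
`g` such a path, only finitely many summands are nonzero, and this is the pathwise
Lebesgue-Stieltjes integral, with which the semimartingale integral agrees almost surely. -/
noncomputable def expIntegral (f g : ℝ≥0 → ℝ) (t : ℝ≥0) : ℝ :=
  ∑' s : Set.Ioc (0 : ℝ≥0) t,
    Real.exp (-Function.leftLim f (s : ℝ≥0)) * (g s - Function.leftLim g (s : ℝ≥0))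

/-- The random variable `V` is (a version of) the exponential functional
`∫_0^τ exp (-ξ_{s-}) dη_s`, killed at the random time `τ`. -/
structure IsKilledExpFunctional {Ω : Type*} [MeasurableSpace Ω] (V : Ω → ℝ)
    (ξ η : ℝ≥0 → Ω → ℝ) (τ : Ω → ℝ≥0) (P : Measure Ω) : Prop where
  aemeasurable : AEMeasurable V P
  ae_eq : ∀ᵐ ω ∂P, V ω = expIntegral (fun t ↦ ξ t ω) (fun t ↦ η t ω) (τ ω)

/-- The support of a real random variable: the support of its law. -/
noncomputable def rvSupport {Ω : Type*} [MeasurableSpace Ω] (X : Ω → ℝ) (P : Measure Ω) : Set ℝ :=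
  (P.map X).support

end KilledExp

/-! The path of `(ξ, η)` can follow any finite list of jumps, one at a time, with sizes near
prescribed points of `supp νξ` and `supp νη`, and be idle when `τ` arrives. This has positive
probability, and `V` is then close to the finite sum the list determines. So `supp V` contains the
closure `C` of the set of such sums (`jumpValues_subset_rvSupport`). Prepending an `η`-jump `z` to a
list turns its value `v` into `z + v`; prepending a `ξ`-jump `x` turns it into `exp (-x) * v`. Hence
`C` is closed, contains `0` and is stable under both operations (`isStable_jumpValues`,
`IsStable.closure`). All five claims are deterministic consequences: multiples of an interval
eventually overlap (additively for `νη`, after taking logarithms for `νξ`), a half-line and a jump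
of the opposite sign fill the line, and an irrational ratio gives arbitrarily small steps.
Positivity is proved on dyadic grids: by independence, the probability of a pattern has a lower
bound free of the mesh (`stepBound_le`). It therefore survives the limit, where right-continuity
recovers true step paths. -/

namespace KilledExp

/-! ### Stable sets and the half-lines they contain -/

/-- A set containing `0` that is stable under adding an element of `A` and under multiplication by
`exp (-x)` for `x ∈ B`. -/
structure IsStable (A B C : Set ℝ) : Prop where
  zero_mem : (0 : ℝ) ∈ C
  add_mem : ∀ z ∈ A, ∀ v ∈ C, z + v ∈ C
  exp_mul_mem : ∀ x ∈ B, ∀ v ∈ C, Real.exp (-x) * v ∈ C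

namespace IsStable

variable {A B C : Set ℝ}

lemma neg (h : IsStable A B C) : IsStable (-A) B (-C) where
  zero_mem := by simpa using h.zero_mem
  add_mem z hz v hv := by
    have := h.add_mem _ hz _ hv
    rw [Set.mem_neg]
    convert! this using 1
    ring
  exp_mul_mem x hx v hv := by
    have := h.exp_mul_mem _ hx _ hv
    rw [Set.mem_neg]
    convert! this using 1
    ring

lemma nsmul_add_mem (h : IsStable A B C) {z v : ℝ} (hz : z ∈ A) (hv : v ∈ C) (n : ℕ) :
    n * z + v ∈ C := by
  induction n with
  | zero => simpa using hv
  | succ n ih =>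
    have := h.add_mem z hz _ ih
    convert! this using 1
    push_cast
    ring

lemma exp_nsmul_mul_mem (h : IsStable A B C) {x v : ℝ} (hx : x ∈ B) (hv : v ∈ C) (n : ℕ) :
    Real.exp (-(n * x)) * v ∈ C := by
  induction n with
  | zero => simpa using hv
  | succ n ih =>
    have := h.exp_mul_mem x hx _ ih
    rw [← mul_assoc, ← Real.exp_add] at this
    convert! this using 3
    push_cast
    ring

lemma subset_of_subset (h : IsStable A B C) : A ⊆ C := fun z hz ↦ by
  simpa using h.add_mem z hz 0 h.zero_mem

/-- Repeated translation by the negative `z` pushes the half-line arbitrarily far to the left. -/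
lemma eq_univ_of_Ici (h : IsStable A B C) {a z : ℝ} (ha : Set.Ici a ⊆ C) (hz : z ∈ A)
    (hz0 : z < 0) : C = Set.univ := by
  refine Set.eq_univ_of_forall fun y ↦ ?_
  obtain ⟨n, hn⟩ := exists_nat_gt ((a - y) / -z)
  rw [div_lt_iff₀ (by linarith)] at hn
  have := h.nsmul_add_mem hz (ha (show a ≤ y - n * z by linarith)) n
  simpa using this

/-- The multiples of an interval `[a, b]` cover a half-line. -/
lemma _root_.KilledExp.exists_nat_mul_le {a b y : ℝ} (ha : 0 < a) (hab : a < b) {k : ℤ}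
    (hk : k = ⌊a / (b - a)⌋ + 1) (hy : k * a ≤ y) :
    ∃ n : ℕ, 1 ≤ n ∧ n * a ≤ y ∧ y ≤ n * b := by
  have hk1 : (1 : ℤ) ≤ k := by
    have : 0 ≤ ⌊a / (b - a)⌋ := Int.floor_nonneg.2 (div_nonneg ha.le (by linarith))
    omega
  have hk1' : (1 : ℝ) ≤ k := by exact_mod_cast hk1
  -- For `n ≥ k` this gives `(n + 1) * a < n * b`: consecutive multiples of the interval overlap, so
  -- `n = ⌊y / a⌋₊` works.
  have hk2 : a < k * (b - a) := by
    rw [← div_lt_iff₀ (by linarith), hk]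
    push_cast
    exact Int.lt_floor_add_one _
  have hy0 : 0 ≤ y / a := div_nonneg (by nlinarith) ha.le
  have hkn : k ≤ (⌊y / a⌋₊ : ℤ) := by
    rw [Int.natCast_floor_eq_floor hy0, Int.le_floor, le_div_iff₀ ha]
    exact hy
  have hkn' : (k : ℝ) ≤ (⌊y / a⌋₊ : ℝ) := by exact_mod_cast hkn
  refine ⟨⌊y / a⌋₊, by omega, ?_, ?_⟩
  · rw [← le_div_iff₀ ha]
    exact Nat.floor_le hy0
  · have := Nat.lt_floor_add_one (y / a)
    rw [div_lt_iff₀ ha] at this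
    nlinarith

lemma Icc_mul_subset (h : IsStable A B C) {a b : ℝ} (hA : Set.Icc a b ⊆ A) {n : ℕ} (hn : 1 ≤ n) :
    Set.Icc (n * a) (n * b) ⊆ C := by
  intro y hy
  have hn0 : (0 : ℝ) < n := by exact_mod_cast hn
  have : y / n ∈ Set.Icc a b :=
    ⟨by rw [le_div_iff₀ hn0]; linarith [hy.1], by rw [div_le_iff₀ hn0]; linarith [hy.2]⟩
  have := h.nsmul_add_mem (hA this) h.zero_mem n
  rwa [mul_div_cancel₀ _ hn0.ne', add_zero] at this

lemma Ici_mul_subset (h : IsStable A B C) {a b : ℝ} (ha : 0 < a) (hab : a < b)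
    (hA : Set.Icc a b ⊆ A) {k : ℤ} (hk : k = ⌊a / (b - a)⌋ + 1) : Set.Ici (k * a) ⊆ C := by
  intro y hy
  obtain ⟨n, hn, h1, h2⟩ := exists_nat_mul_le ha hab hk hy
  exact h.Icc_mul_subset hA hn ⟨h1, h2⟩

/-- In logarithmic scale, `n` multiplications by `exp (-x)` with `x ∈ [β, α]` add a point of `n •
[-α, -β]` to `log z`, so the covering by multiples of an interval applies to `log (y / z)`. -/
lemma Ici_exp_mul_subset (h : IsStable A B C) {α β z : ℝ} (hα : α < 0) (hβα : β < α)
    (hB : Set.Icc β α ⊆ B) {k : ℤ} (hk : k = ⌊α / (β - α)⌋ + 1) (hz : z ∈ A) (hz0 : 0 < z) :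
    Set.Ici (Real.exp (-k * α) * z) ⊆ C := by
  intro y hy
  rw [Set.mem_Ici] at hy
  have hy0 : 0 < y := (mul_pos (Real.exp_pos _) hz0).trans_le hy
  have hl : k * -α ≤ Real.log (y / z) := by
    rw [Real.le_log_iff_exp_le (div_pos hy0 hz0), le_div_iff₀ hz0]
    convert! hy using 3
    ring
  obtain ⟨n, hn, h1, h2⟩ := exists_nat_mul_le (b := -β) (neg_pos.2 hα) (by linarith)
    (by rw [hk, ← neg_div_neg_eq]; congr 3; ring) hl
  have hn0 : (0 : ℝ) < n := by exact_mod_cast hn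
  have hx : -(Real.log (y / z) / n) ∈ Set.Icc β α := by
    constructor
    · have : Real.log (y / z) / n ≤ -β := by rw [div_le_iff₀ hn0]; linarith
      linarith
    · have : -α ≤ Real.log (y / z) / n := by rw [le_div_iff₀ hn0]; linarith
      linarith
  have := h.exp_nsmul_mul_mem (hB hx) (h.subset_of_subset hz) n
  rwa [mul_neg, neg_neg, mul_div_cancel₀ _ hn0.ne', Real.exp_log (div_pos hy0 hz0),
    div_mul_cancel₀ _ hz0.ne'] at this

/-- Each multiplication by `exp (-x)` stretches by a factor at most `b / a`, so the images of `[a,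
b]` leave no gap: dividing `y` by that factor as often as it stays above `a` lands in `[a, b]`. -/
lemma Ici_subset_of_log (h : IsStable A B C) {a b x : ℝ} (ha : 0 < a) (hab : a < b)
    (hA : Set.Icc a b ⊆ A) (hx : x ∈ B) (hx0 : x < 0) (hlog : -x ≤ Real.log (b / a)) :
    Set.Ici a ⊆ C := by
  intro y hy
  rw [Set.mem_Ici] at hy
  have hy0 : 0 < y := ha.trans_le hy
  have hl : 0 ≤ Real.log (y / a) := Real.log_nonneg (by rwa [le_div_iff₀ ha, one_mul])
  set n := ⌊Real.log (y / a) / -x⌋₊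
  have h1 : n * -x ≤ Real.log (y / a) := by
    rw [← le_div_iff₀ (by linarith)]
    exact Nat.floor_le (div_nonneg hl (by linarith))
  have h2 : Real.log (y / a) < (n + 1) * -x := by
    rw [← div_lt_iff₀ (by linarith)]
    exact Nat.lt_floor_add_one _
  rw [Real.log_div hy0.ne' ha.ne'] at h1 h2
  rw [Real.log_div (by linarith) ha.ne'] at hlog
  have hu : Real.exp (n * x) * y ∈ Set.Icc a b := by
    constructor
    · rw [← Real.log_le_log_iff ha (by positivity), Real.log_mul (Real.exp_pos _).ne' hy0.ne',
        Real.log_exp]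
      linarith
    · rw [← Real.log_le_log_iff (by positivity) (by linarith),
        Real.log_mul (Real.exp_pos _).ne' hy0.ne', Real.log_exp]
      linarith
  have := h.exp_nsmul_mul_mem hx (h.subset_of_subset (hA hu)) n
  rwa [← mul_assoc, ← Real.exp_add, neg_add_cancel, Real.exp_zero, one_mul] at this

/-- The group generated by `z₁`, `z₂` is dense, but only nonnegative combinations are available. A
small group element turns out to have coefficients of equal sign, so it or its negative is available
as a step; a multiple of the jump of the other direction supplies the starting point. -/
lemma eq_univ_of_irrational (h : IsStable A B C) (hC : IsClosed C) {z₁ z₂ : ℝ} (h₁ : z₁ ∈ A)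
    (h₂ : z₂ ∈ A) (hz₁ : z₁ < 0) (hz₂ : 0 < z₂) (hirr : Irrational (z₂ / z₁)) :
    C = Set.univ := by
  have key : ∀ m n : ℕ, m * z₁ + n * z₂ ∈ C := fun m n ↦ by
    have := h.nsmul_add_mem h₁ (h.nsmul_add_mem h₂ h.zero_mem n) m
    simpa using this
  have hd : Dense (AddSubgroup.closure {z₂, z₁} : Set ℝ) :=
    dense_addSubgroupClosure_pair_iff.2 hirr
  refine Set.eq_univ_of_forall fun y ↦ hC.closure_subset (Metric.mem_closure_iff.2 fun ε hε ↦ ?_)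
  -- Being smaller than both `-z₁` and `z₂` is what excludes coefficients of opposite sign: such a
  -- combination would be too large or negative.
  have hmin : 0 < min ε (min (-z₁) z₂) := by simp [hε, hz₁, hz₂]
  obtain ⟨g, hg, hg0, hgε⟩ := hd.exists_mem_open isOpen_Ioo (Set.nonempty_Ioo.2 hmin)
  obtain ⟨hgε, hg1, hg2⟩ : g < ε ∧ g < -z₁ ∧ g < z₂ := by simpa using hgε
  obtain ⟨n, m, rfl⟩ := AddSubgroup.mem_closure_pair.1 hg
  simp only [zsmul_eq_mul] at *
  obtain ⟨k₁, hk₁⟩ := exists_nat_gt (y / z₁)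
  obtain ⟨k₂, hk₂⟩ := exists_nat_gt (y / z₂)
  rw [div_lt_iff_of_neg hz₁] at hk₁
  rw [div_lt_iff₀ hz₂] at hk₂
  set g : ℝ := n * z₂ + m * z₁ with hgdef
  -- Here `g` itself is attainable: start at `k₁ * z₁ < y` and move right. Otherwise `-g` is: start
  -- at `k₂ * z₂ > y` and move left.
  by_cases hn : 0 ≤ n
  · have hm : 0 ≤ m := by
      by_contra! hm
      have h1 : (m : ℝ) ≤ -1 := by exact_mod_cast (by omega : m ≤ -1)
      have h2 : (0 : ℝ) ≤ n := by exact_mod_cast hn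
      nlinarith
    lift n to ℕ using hn
    lift m to ℕ using hm
    have hj0 : 0 ≤ (y - k₁ * z₁) / g := div_nonneg (by linarith) hg0.le
    set j := ⌊(y - k₁ * z₁) / g⌋₊
    have hj1 : j * g ≤ y - k₁ * z₁ := by rw [← le_div_iff₀ hg0]; exact Nat.floor_le hj0
    have hj2 : y - k₁ * z₁ < (j + 1) * g := by
      rw [← div_lt_iff₀ hg0]; exact Nat.lt_floor_add_one _
    refine ⟨_, key (k₁ + j * m) (j * n), ?_⟩
    push_cast at hgdef ⊢
    rw [Real.dist_eq, abs_lt]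
    constructor <;> nlinarith
  · have hm : m ≤ 0 := by
      by_contra! hm
      have h1 : (1 : ℝ) ≤ m := by exact_mod_cast (by omega : 1 ≤ m)
      have h2 : (n : ℝ) ≤ -1 := by exact_mod_cast (by omega : n ≤ -1)
      nlinarith
    obtain ⟨n', hn'⟩ := Int.eq_ofNat_of_zero_le (by omega : 0 ≤ -n)
    obtain ⟨m', hm'⟩ := Int.eq_ofNat_of_zero_le (by omega : 0 ≤ -m)
    have hn'' : (n : ℝ) = -n' := by
      have : n = -n' := by omega
      rw [this]; push_cast; ring
    have hm'' : (m : ℝ) = -m' := by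
      have : m = -m' := by omega
      rw [this]; push_cast; ring
    have hj0 : 0 ≤ (k₂ * z₂ - y) / g := div_nonneg (by linarith) hg0.le
    set j := ⌊(k₂ * z₂ - y) / g⌋₊
    have hj1 : j * g ≤ k₂ * z₂ - y := by rw [← le_div_iff₀ hg0]; exact Nat.floor_le hj0
    have hj2 : k₂ * z₂ - y < (j + 1) * g := by
      rw [← div_lt_iff₀ hg0]; exact Nat.lt_floor_add_one _
    refine ⟨_, key (j * m') (k₂ + j * n'), ?_⟩
    push_cast
    rw [Real.dist_eq, abs_lt]
    rw [hn'', hm''] at hgdef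
    constructor <;> nlinarith

end IsStable

end KilledExp

/-! ### Compound Poisson laws as Poisson mixtures of convolution powers -/

namespace KilledExp

open scoped ENNReal Nat

/-- The `n`-fold convolution power of a measure on the line. -/
noncomputable def convPow (ν : Measure ℝ) : ℕ → Measure ℝ
  | 0 => Measure.dirac 0
  | n + 1 => convPow ν n ∗ ν

instance isFiniteMeasure_convPow (ν : Measure ℝ) [IsFiniteMeasure ν] (n : ℕ) :
    IsFiniteMeasure (convPow ν n) := by
  induction n with
  | zero => simp only [convPow]; infer_instance
  | succ n ih => simp only [convPow]; infer_instance

lemma convPow_univ (ν : Measure ℝ) [IsFiniteMeasure ν] (n : ℕ) :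
    convPow ν n Set.univ = ν Set.univ ^ n := by
  induction n with
  | zero => simp [convPow]
  | succ n ih =>
    rw [convPow, Measure.conv, Measure.map_apply (by fun_prop) MeasurableSet.univ,
      Set.preimage_univ, ← Set.univ_prod_univ, Measure.prod_prod, ih, pow_succ]

lemma charFun_convPow (ν : Measure ℝ) [IsFiniteMeasure ν] (n : ℕ) (z : ℝ) :
    charFun (convPow ν n) z = charFun ν z ^ n := by
  induction n with
  | zero => simp [convPow, charFun_dirac]
  | succ n ih => rw [convPow, charFun_conv, ih, pow_succ]

lemma convPow_compl_eq_zero (ν : Measure ℝ) [IsFiniteMeasure ν] {C : Set ℝ}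
    (hC : MeasurableSet C) (h0 : (0 : ℝ) ∈ C) (hadd : ∀ x ∈ C, ∀ y ∈ C, x + y ∈ C)
    (hν : ν Cᶜ = 0) (n : ℕ) : convPow ν n Cᶜ = 0 := by
  induction n with
  | zero => simp [convPow, hC.compl, h0]
  | succ n ih =>
    rw [convPow, Measure.conv, Measure.map_apply (by fun_prop) hC.compl]
    have : (fun x : ℝ × ℝ ↦ x.1 + x.2) ⁻¹' Cᶜ ⊆ Cᶜ ×ˢ Set.univ ∪ Set.univ ×ˢ Cᶜ := by
      rintro ⟨x, y⟩ hxy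
      by_contra h
      simp only [Set.mem_union, Set.mem_prod, Set.mem_compl_iff, Set.mem_univ, and_true,
        true_and, not_or, not_not] at h
      exact hxy (hadd _ h.1 _ h.2)
    refine measure_mono_null this (measure_union_null ?_ ?_) <;> simp [Measure.prod_prod, ih, hν]

/-- The compound Poisson distribution at time `t` with Lévy measure `ν`. -/
noncomputable def cpLaw (ν : Measure ℝ) (t : ℝ≥0) : Measure ℝ :=
  ENNReal.ofReal (Real.exp (-(t * ν.real Set.univ))) •
    Measure.sum fun n ↦ (t ^ n / (n ! : ℝ≥0)) • convPow ν n

instance isFiniteMeasure_sum_convPow (ν : Measure ℝ) [IsFiniteMeasure ν] (t : ℝ≥0) :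
    IsFiniteMeasure (Measure.sum fun n : ℕ ↦ (t ^ n / (n ! : ℝ≥0)) • convPow ν n) := by
  refine ⟨?_⟩
  rw [Measure.sum_apply _ MeasurableSet.univ]
  have hs : Summable fun n : ℕ ↦ (t * (ν Set.univ).toNNReal) ^ n / (n ! : ℝ≥0) := by
    rw [← NNReal.summable_coe]
    push_cast
    exact Real.summable_pow_div_factorial _
  have h : ∀ n : ℕ, ((t ^ n / (n ! : ℝ≥0)) • convPow ν n) Set.univ =
      (((t * (ν Set.univ).toNNReal) ^ n / (n ! : ℝ≥0) : ℝ≥0) : ℝ≥0∞) := by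
    intro n
    rw [Measure.smul_apply, convPow_univ, mul_pow, mul_div_right_comm, ENNReal.coe_mul,
      ENNReal.coe_pow, ENNReal.coe_toNNReal (measure_ne_top _ _)]
    rfl
  simp_rw [h]
  exact (ENNReal.tsum_coe_ne_top_iff_summable.2 hs).lt_top

instance isFiniteMeasure_cpLaw (ν : Measure ℝ) [IsFiniteMeasure ν] (t : ℝ≥0) :
    IsFiniteMeasure (cpLaw ν t) := by
  unfold cpLaw
  exact Measure.smul_finite _ ENNReal.ofReal_ne_top

lemma integrable_cexp_mul_I (μ : Measure ℝ) [IsFiniteMeasure μ] (z : ℝ) :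
    Integrable (fun x : ℝ ↦ Complex.exp ((z : ℂ) * (x : ℂ) * Complex.I)) μ := by
  refine Integrable.of_bound (C := 1) (by fun_prop) (ae_of_all _ fun x ↦ ?_)
  rw [← Complex.ofReal_mul, Complex.norm_exp_ofReal_mul_I]

/-- The convolution powers sum to the exponential series of `t * charFun ν z`; the normalising
factor accounts for the `-1` in the integrand. -/
lemma charFun_cpLaw (ν : Measure ℝ) [IsFiniteMeasure ν] (t : ℝ≥0) (z : ℝ) :
    charFun (cpLaw ν t) z =
      Complex.exp ((t : ℂ) * ∫ x : ℝ, (Complex.exp ((z : ℂ) * (x : ℂ) * Complex.I) - 1) ∂ν) := by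
  have h1 : ∫ x : ℝ, (Complex.exp ((z : ℂ) * (x : ℂ) * Complex.I) - 1) ∂ν =
      charFun ν z - (ν.real Set.univ : ℂ) := by
    rw [integral_sub (integrable_cexp_mul_I ν z) (integrable_const _), charFun_apply_real]
    simp
  have h2 := hasSum_integral_measure (integrable_cexp_mul_I
    (Measure.sum fun n : ℕ ↦ (t ^ n / (n ! : ℝ≥0)) • convPow ν n) z)
  have h3 : ∀ n : ℕ, ∫ x : ℝ, Complex.exp ((z : ℂ) * (x : ℂ) * Complex.I)
      ∂((t ^ n / (n ! : ℝ≥0)) • convPow ν n) = ((t : ℂ) * charFun ν z) ^ n / (n ! : ℂ) := by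
    intro n
    rw [integral_smul_nnreal_measure, ← charFun_apply_real, charFun_convPow, mul_pow,
      mul_div_right_comm, NNReal.smul_def, Complex.real_smul]
    push_cast
    rfl
  simp_rw [h3] at h2
  have h4 := h2.unique (NormedSpace.expSeries_div_hasSum_exp ((t : ℂ) * charFun ν z))
  rw [charFun_apply_real, cpLaw, integral_smul_measure, h4, h1,
    ENNReal.toReal_ofReal (Real.exp_pos _).le, Complex.real_smul, ← Complex.exp_eq_exp_ℂ]
  push_cast
  rw [← Complex.exp_add]
  congr 1
  ring

lemma cpLaw_compl_eq_zero (ν : Measure ℝ) [IsFiniteMeasure ν] {C : Set ℝ}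
    (hC : MeasurableSet C) (h0 : (0 : ℝ) ∈ C) (hadd : ∀ x ∈ C, ∀ y ∈ C, x + y ∈ C)
    (hν : ν Cᶜ = 0) (t : ℝ≥0) : cpLaw ν t Cᶜ = 0 := by
  simp [cpLaw, Measure.sum_apply _ hC.compl, convPow_compl_eq_zero ν hC h0 hadd hν]

/-- One term of the mixture is a lower bound. The terms `n = 0` (no jump) and `n = 1` (one jump) are
the ones needed. -/
lemma smul_convPow_le_cpLaw (ν : Measure ℝ) (t : ℝ≥0) (n : ℕ) :
    ENNReal.ofReal (Real.exp (-(t * ν.real Set.univ))) • (t ^ n / (n ! : ℝ≥0)) • convPow ν n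
      ≤ cpLaw ν t := by
  unfold cpLaw
  gcongr
  exact Measure.le_sum (fun n : ℕ ↦ (t ^ n / (n ! : ℝ≥0)) • convPow ν n) n

lemma le_cpLaw_singleton_zero (ν : Measure ℝ) (t : ℝ≥0) :
    ENNReal.ofReal (Real.exp (-(t * ν.real Set.univ))) ≤ cpLaw ν t {0} := by
  have := smul_convPow_le_cpLaw ν t 0 {0}
  simpa only [convPow, pow_zero, Nat.factorial_zero, Nat.cast_one, div_one, one_smul,
    Measure.smul_apply, Measure.dirac_apply_of_mem (Set.mem_singleton _), smul_eq_mul,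
    mul_one] using this

lemma le_cpLaw (ν : Measure ℝ) [IsFiniteMeasure ν] (t : ℝ≥0) (U : Set ℝ) :
    ENNReal.ofReal (Real.exp (-(t * ν.real Set.univ))) * (t * ν U) ≤ cpLaw ν t U := by
  have := smul_convPow_le_cpLaw ν t 1 U
  have h : convPow ν 1 = ν := by simp [convPow]
  rw [h] at this
  simpa only [pow_one, Nat.factorial_one, Nat.cast_one, div_one, Measure.smul_apply,
    ENNReal.smul_def, smul_eq_mul] using this

variable {Ω : Type*} [MeasurableSpace Ω] {P : Measure Ω} [IsProbabilityMeasure P]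
  {X : ℝ≥0 → Ω → ℝ} {ν : Measure ℝ}

/-- Jumps are known only through the characteristic function; its injectivity makes the explicit
mixture, with its lower bounds, available. -/
lemma IsCompoundPoisson.map_eq (h : IsCompoundPoisson X ν P) (t : ℝ≥0) :
    P.map (X t) = cpLaw ν t := by
  have := h.finite
  have := Measure.isProbabilityMeasure_map (μ := P) (h.isLevy.measurable t).aemeasurable
  refine Measure.ext_of_charFun (funext fun z ↦ ?_)
  rw [h.charFun_eq, charFun_cpLaw]

end KilledExp

/-! ### Step paths seen on dyadic grids, and their exponential integral -/

namespace KilledExp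

/-- The dyadic point `k / 2 ^ m`. -/
noncomputable def dyadic (m k : ℕ) : ℝ≥0 := (k : ℝ≥0) / 2 ^ m

lemma dyadic_mul (m i : ℕ) : dyadic m (i * 2 ^ m) = i := by
  simp [dyadic]

lemma dyadic_mono (m : ℕ) : Monotone (dyadic m) := fun a b h ↦ by
  unfold dyadic
  gcongr

lemma dyadic_succ (m k : ℕ) : dyadic (m + 1) (2 * k) = dyadic m k := by
  unfold dyadic
  rw [pow_succ', Nat.cast_mul, Nat.cast_ofNat, mul_div_mul_left _ _ two_ne_zero]

/-- On the dyadic points of level `m` in `[i, i + 1]` the path `f` makes at most one step, and its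
total increment lies in `U`. -/
def DyadicStep (m i : ℕ) (U : Set ℝ) (f : ℝ≥0 → ℝ) : Prop :=
  f (i + 1) - f i ∈ U ∧ ∀ k l : ℕ, i * 2 ^ m ≤ k → k ≤ l → l ≤ (i + 1) * 2 ^ m →
    f (dyadic m k) = f i ∨ f (dyadic m l) = f (i + 1)

lemma DyadicStep.of_succ {m i : ℕ} {U : Set ℝ} {f : ℝ≥0 → ℝ} (h : DyadicStep (m + 1) i U f) :
    DyadicStep m i U f := by
  refine ⟨h.1, fun k l hk hkl hl ↦ ?_⟩
  rw [← dyadic_succ m k, ← dyadic_succ m l]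
  refine h.2 _ _ ?_ (by omega) ?_
  · rw [pow_succ']; nlinarith
  · rw [pow_succ']; nlinarith

lemma antitone_dyadicStep (i : ℕ) (U : Set ℝ) (f : ℝ≥0 → ℝ) :
    Antitone fun m ↦ DyadicStep m i U f :=
  antitone_nat_of_succ_le fun _ h ↦ h.of_succ

lemma measurableSet_dyadicStep (m i : ℕ) {U : Set ℝ} (hU : MeasurableSet U) :
    MeasurableSet {f : ℝ≥0 → ℝ | DyadicStep m i U f} := by
  have h1 : MeasurableSet {f : ℝ≥0 → ℝ | f (i + 1) - f i ∈ U} :=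
    measurableSet_preimage (by fun_prop : Measurable fun f : ℝ≥0 → ℝ ↦ f (i + 1) - f i) hU
  have h2 : ∀ s t : ℝ≥0, MeasurableSet {f : ℝ≥0 → ℝ | f s = f t} := fun s t ↦
    measurableSet_eq_fun (measurable_pi_apply _) (measurable_pi_apply _)
  unfold DyadicStep
  simp only [Set.ofPred_and, Set.ofPred_forall, Set.ofPred_or]
  refine h1.inter (MeasurableSet.iInter fun k ↦ MeasurableSet.iInter fun l ↦
    MeasurableSet.iInter fun _ ↦ MeasurableSet.iInter fun _ ↦ MeasurableSet.iInter fun _ ↦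
    (h2 _ _).union (h2 _ _))

/-- Every point is the limit of dyadic points strictly to its right. -/
lemma tendsto_dyadic_floor (t : ℝ≥0) :
    Tendsto (fun m : ℕ ↦ dyadic m (⌊t * 2 ^ m⌋₊ + 1)) atTop (𝓝[>] t) := by
  have hlt : ∀ m : ℕ, t < dyadic m (⌊t * 2 ^ m⌋₊ + 1) := fun m ↦ by
    rw [dyadic, lt_div_iff₀ (by positivity)]
    push_cast
    exact Nat.lt_floor_add_one _
  have hle : ∀ m : ℕ, dyadic m (⌊t * 2 ^ m⌋₊ + 1) ≤ t + (1 / 2) ^ m := fun m ↦ by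
    rw [dyadic, div_le_iff₀ (by positivity), add_mul, ← mul_pow]
    push_cast
    have := Nat.floor_le (zero_le : 0 ≤ t * 2 ^ m)
    rw [one_div, inv_mul_cancel₀ two_ne_zero, one_pow]
    gcongr
  refine tendsto_nhdsWithin_iff.2 ⟨?_, .of_forall hlt⟩
  refine tendsto_of_tendsto_of_tendsto_of_le_of_le tendsto_const_nhds ?_ (fun m ↦ (hlt m).le) hle
  simpa using tendsto_const_nhds.add
    (tendsto_pow_atTop_nhds_zero_of_lt_one (r := (1 / 2 : ℝ≥0)) (by simp)
      (by rw [div_lt_one two_pos]; exact one_lt_two))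

lemma IsCadlag.tendsto_right {f : ℝ≥0 → ℝ} (hf : IsCadlag f) (t : ℝ≥0) :
    Tendsto f (𝓝[>] t) (𝓝 (f t)) :=
  (hf t).1.tendsto.mono_left (nhdsWithin_mono _ Set.Ioi_subset_Ici_self)

lemma IsCadlag.tendsto_dyadic {f : ℝ≥0 → ℝ} (hf : IsCadlag f) (t : ℝ≥0) :
    Tendsto (fun m : ℕ ↦ f (dyadic m (⌊t * 2 ^ m⌋₊ + 1))) atTop (𝓝 (f t)) :=
  (hf.tendsto_right t).comp (tendsto_dyadic_floor t)

/-- On `[i, i + 1]`, the path `f` has at most one step. -/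
def IsStepOn (i : ℕ) (f : ℝ≥0 → ℝ) : Prop :=
  ∀ s t : ℝ≥0, i ≤ s → s ≤ t → t ≤ i + 1 → f s = f i ∨ f t = f (i + 1)

/-- A violation at `s ≤ t` consists of two inequalities `≠`, which right-continuity carries to
dyadic points just to the right. For these to stay in the interval, `t = i + 1` is treated apart. -/
lemma IsCadlag.isStepOn {f : ℝ≥0 → ℝ} (hf : IsCadlag f) {i : ℕ} {U : Set ℝ}
    (h : ∀ m, DyadicStep m i U f) : IsStepOn i f := by
  intro s t his hst hti
  rcases hti.eq_or_lt with rfl | hti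
  · exact .inr rfl
  by_contra! hne
  have e1 := (hf.tendsto_dyadic s).eventually_ne hne.1
  have e2 := (hf.tendsto_dyadic t).eventually_ne hne.2
  have e3 : ∀ᶠ m in atTop, dyadic m (⌊t * 2 ^ m⌋₊ + 1) < i + 1 :=
    ((tendsto_dyadic_floor t).mono_right nhdsWithin_le_nhds).eventually_lt_const hti
  obtain ⟨m, h1, h2, h3⟩ := (e1.and (e2.and e3)).exists
  have hpos : (0 : ℝ≥0) < 2 ^ m := by positivity
  have hk : i * 2 ^ m ≤ ⌊s * 2 ^ m⌋₊ + 1 := by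
    refine (Nat.le_floor ?_).trans (Nat.le_succ _)
    push_cast
    gcongr
  have hkl : ⌊s * 2 ^ m⌋₊ + 1 ≤ ⌊t * 2 ^ m⌋₊ + 1 := by gcongr
  have hl : ⌊t * 2 ^ m⌋₊ + 1 ≤ (i + 1) * 2 ^ m := by
    rw [dyadic, div_lt_iff₀ hpos] at h3
    exact_mod_cast h3.le
  exact ((h m).2 _ _ hk hkl hl).elim h1 h2

lemma IsStepOn.eq_left {f : ℝ≥0 → ℝ} {i : ℕ} (h : IsStepOn i f) (hi : f (i + 1) = f i) {t : ℝ≥0}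
    (h1 : i ≤ t) (h2 : t ≤ i + 1) : f t = f i :=
  (h t t h1 le_rfl h2).elim id fun h ↦ h.trans hi

lemma IsStepOn.exists_jump {f : ℝ≥0 → ℝ} {i : ℕ} (h : IsStepOn i f) (hf : IsCadlag f) :
    ∃ s : ℝ≥0, i < s ∧ s ≤ i + 1 ∧ (∀ t : ℝ≥0, i ≤ t → t < s → f t = f i) ∧
      ∀ t : ℝ≥0, s ≤ t → t ≤ i + 1 → f t = f (i + 1) := by
  by_cases hi : f (i + 1) = f i
  -- Without a step any time in the interval would do; the infimum used below would be `i` itself,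
  -- which is not allowed.
  · refine ⟨i + 1, lt_add_one _, le_rfl, fun t h1 h2 ↦ h.eq_left hi h1 h2.le,
      fun t h1 h2 ↦ by rw [le_antisymm h2 h1]⟩
  -- The step occurs when the final value is first reached; right-continuity shows that it is
  -- attained at the infimum.
  set S : Set ℝ≥0 := {t | i ≤ t ∧ t ≤ i + 1 ∧ f t = f (i + 1)}
  have hne : S.Nonempty := ⟨i + 1, by simp, le_rfl, rfl⟩
  have hbdd : BddBelow S := OrderBot.bddBelow S
  have hs1 : i ≤ sInf S := le_csInf hne fun t ht ↦ ht.1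
  have hs2 : sInf S ≤ i + 1 := csInf_le hbdd ⟨by simp, le_rfl, rfl⟩
  have hgt : ∀ t, sInf S < t → t ≤ i + 1 → f t = f (i + 1) := fun t h1 h2 ↦ by
    obtain ⟨u, hu, hut⟩ := exists_lt_of_csInf_lt hne h1
    exact (h u t hu.1 hut.le h2).resolve_left fun hc ↦ hi (hu.2.2.symm.trans hc)
  have hs : f (sInf S) = f (i + 1) := by
    rcases hs2.eq_or_lt with h2 | h2
    · rw [h2]
    · refine tendsto_nhds_unique (hf.tendsto_right _) (tendsto_const_nhds.congr' ?_)
      filter_upwards [Ioo_mem_nhdsGT h2] with t ht using (hgt t ht.1 ht.2.le).symm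
  refine ⟨sInf S, hs1.lt_of_ne fun hc ↦ hi ?_, hs2, fun t h1 h2 ↦ ?_, fun t h1 h2 ↦ ?_⟩
  · rw [← hs, ← hc]
  · exact (h t t h1 le_rfl (h2.le.trans hs2)).resolve_right fun hc ↦
      (csInf_le hbdd ⟨h1, h2.le.trans hs2, hc⟩).not_gt h2
  · rcases h1.eq_or_lt with rfl | h1
    · exact hs
    · exact hgt t h1 h2

lemma leftLim_eq_of_eqOn {f : ℝ≥0 → ℝ} {a s : ℝ≥0} {c : ℝ} (has : a < s)
    (h : ∀ t, a ≤ t → t < s → f t = c) : Function.leftLim f s = c := by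
  have : (𝓝[<] s).NeBot := nhdsLT_neBot_of_exists_lt ⟨a, has⟩
  refine leftLim_eq_of_tendsto (tendsto_const_nhds.congr' ?_)
  filter_upwards [Ioo_mem_nhdsLT has] with t ht using (h t ht.1.le ht.2).symm

/-- The exponential integral of a pair of step functions which on each unit interval make at most
one step, and not both. -/
lemma expIntegral_eq_sum {f g : ℝ≥0 → ℝ} (hg : IsCadlag g) {n : ℕ}
    (hfs : ∀ i ≤ n, IsStepOn i f) (hgs : ∀ i ≤ n, IsStepOn i g)
    (hfg : ∀ i < n, f (i + 1) = f i ∨ g (i + 1) = g i) (hn : g (n + 1) = g n) {t : ℝ≥0}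
    (h1 : n ≤ t) (h2 : t ≤ n + 1) :
    expIntegral f g t = ∑ i ∈ Finset.range n, Real.exp (-f i) * (g (i + 1) - g i) := by
  choose! s hs1 hs2 hs3 hs4 using fun i (hi : i ≤ n) ↦ (hgs i hi).exists_jump hg
  have hst : ∀ i < n, s i ∈ Set.Ioc 0 t := fun i hi ↦
    ⟨zero_le.trans_lt (hs1 i hi.le), (hs2 i hi.le).trans
      ((by exact_mod_cast hi : (i : ℝ≥0) + 1 ≤ n).trans h1)⟩
  -- The only possible jump of `g` in `(j, j + 1]` is at `s j`, and these intervals are disjoint, so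
  -- the series is a finite sum of terms each supported at one point.
  have hterm : ∀ u : Set.Ioc (0 : ℝ≥0) t,
      Real.exp (-Function.leftLim f (u : ℝ≥0)) * (g u - Function.leftLim g (u : ℝ≥0)) =
      ∑ i ∈ Finset.range n, if (u : ℝ≥0) = s i then Real.exp (-f i) * (g (i + 1) - g i) else 0 := by
    rintro ⟨u, hu0, hut⟩
    dsimp only
    obtain ⟨j, hj⟩ : ∃ j : ℕ, ⌈u⌉₊ = j + 1 := Nat.exists_eq_succ_of_ne_zero (Nat.ceil_pos.2 hu0).ne'
    obtain ⟨hju, huj⟩ := (Nat.ceil_eq_iff (Nat.succ_ne_zero j)).1 hj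
    simp only [Nat.succ_eq_add_one, Nat.add_sub_cancel, Nat.cast_add, Nat.cast_one] at hju huj
    have hjn : j ≤ n := by
      have : (j : ℝ≥0) < n + 1 := hju.trans_le (hut.trans h2)
      exact_mod_cast Nat.lt_succ_iff.1 (by exact_mod_cast this)
    have huniq : ∀ i < n, u = s i → i = j := fun i hi h ↦ by
      have a1 := hs1 i hi.le
      have a2 := hs2 i hi.le
      rw [← h] at a1 a2
      have b1 : (i : ℝ≥0) < j + 1 := a1.trans_le huj
      have b2 : (j : ℝ≥0) < i + 1 := hju.trans_le a2
      have b1' : i < j + 1 := by exact_mod_cast b1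
      have b2' : j < i + 1 := by exact_mod_cast b2
      omega
    have hzero : (u ≠ s j ∨ g (j + 1) = g j) → g u - Function.leftLim g u = 0 := by
      rintro (hne | heq)
      · rcases lt_or_gt_of_ne hne with hlt | hlt
        · rw [leftLim_eq_of_eqOn hju fun t ht1 ht2 ↦ hs3 j hjn t ht1 (ht2.trans hlt),
            hs3 j hjn u hju.le hlt, sub_self]
        · rw [leftLim_eq_of_eqOn hlt fun t ht1 ht2 ↦ hs4 j hjn t ht1 (ht2.le.trans huj),
            hs4 j hjn u hlt.le huj, sub_self]
      · rw [leftLim_eq_of_eqOn hju fun t ht1 ht2 ↦ (hgs j hjn).eq_left heq ht1 (ht2.le.trans huj),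
          (hgs j hjn).eq_left heq hju.le huj, sub_self]
    rcases hjn.eq_or_lt with rfl | hjn'
    · rw [hzero (.inr hn), mul_zero, Finset.sum_eq_zero]
      intro i hi
      rw [Finset.mem_range] at hi
      rw [if_neg fun h ↦ hi.ne (huniq i hi h)]
    · rw [Finset.sum_eq_single_of_mem j (Finset.mem_range.2 hjn') fun i hi hij ↦
        if_neg fun h ↦ hij (huniq i (Finset.mem_range.1 hi) h)]
      by_cases hu : u = s j
      · rw [if_pos hu]
        -- The left limit of `f` equals `f j` if `f` does not step here; if it does, `g` does not,
        -- and both sides vanish.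
        rcases hfg j hjn' with hf | hg'
        · rw [leftLim_eq_of_eqOn hju fun t ht1 ht2 ↦ (hfs j hjn).eq_left hf ht1 (ht2.le.trans huj),
            leftLim_eq_of_eqOn hju fun t ht1 ht2 ↦ hs3 j hjn t ht1 (ht2.trans_eq hu),
            hs4 j hjn u hu.ge huj]
        · rw [hzero (.inr hg'), hg', sub_self, mul_zero, mul_zero]
      · rw [if_neg hu, hzero (.inl hu), mul_zero]
  rw [expIntegral, tsum_congr hterm, Summable.tsum_finsetSum]
  · refine Finset.sum_congr rfl fun i hi ↦ ?_
    have hi' := hst i (Finset.mem_range.1 hi)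
    rw [tsum_eq_single (⟨s i, hi'⟩ : Set.Ioc (0 : ℝ≥0) t)]
    · simp
    · intro u hu
      rw [if_neg fun h ↦ hu (Subtype.ext h)]
  · intro i hi
    have hi' := hst i (Finset.mem_range.1 hi)
    refine summable_of_ne_finset_zero (s := {(⟨s i, hi'⟩ : Set.Ioc (0 : ℝ≥0) t)}) fun u hu ↦ ?_
    rw [if_neg fun h ↦ hu (Finset.mem_singleton.2 (Subtype.ext h))]

end KilledExp

/-! ### Positive probability of prescribed jump patterns -/

namespace KilledExp

open scoped ENNReal

lemma dyadicStep_of_forall_eq {m i : ℕ} {U : Set ℝ} {f : ℝ≥0 → ℝ} {j : ℕ} (hj : j < 2 ^ m)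
    (hU : f (dyadic m (i * 2 ^ m + j + 1)) - f (dyadic m (i * 2 ^ m + j)) ∈ U)
    (h : ∀ l < 2 ^ m, l ≠ j →
      f (dyadic m (i * 2 ^ m + l + 1)) - f (dyadic m (i * 2 ^ m + l)) = 0) :
    DyadicStep m i U f := by
  have hleft : ∀ l ≤ j, f (dyadic m (i * 2 ^ m + l)) = f i := by
    intro l hl
    induction l with
    | zero => rw [add_zero, dyadic_mul]
    | succ l ih => rw [← ih (by omega), ← add_assoc, sub_eq_zero.1 (h l (by omega) (by omega))]
  have hright : ∀ l, j + 1 ≤ l → l ≤ 2 ^ m →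
      f (dyadic m (i * 2 ^ m + l)) = f (dyadic m (i * 2 ^ m + j + 1)) := by
    intro l hl
    induction l, hl using Nat.le_induction with
    | base => intro _; rfl
    | succ l hl ih =>
      intro hl'
      rw [← ih (by omega), ← add_assoc, sub_eq_zero.1 (h l (by omega) (by omega))]
  have hend : f (dyadic m (i * 2 ^ m + j + 1)) = f (i + 1) := by
    rw [← hright (2 ^ m) hj le_rfl, ← Nat.succ_mul, dyadic_mul]
    push_cast
    rfl
  refine ⟨?_, fun k l hk hkl hl ↦ ?_⟩
  · rwa [hend, hleft j le_rfl] at hU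
  · obtain ⟨k, rfl⟩ := Nat.exists_eq_add_of_le hk
    obtain ⟨l, rfl⟩ := Nat.exists_eq_add_of_le (hk.trans hkl)
    rcases le_or_gt k j with hkj | hkj
    · exact .inl (hleft k hkj)
    · exact .inr (by rw [hright l (by omega) (by nlinarith), hend])

section

variable {Ω : Type*} [MeasurableSpace Ω] {P : Measure Ω}

/-- Consecutive blocks of an independent sequence are independent. -/
lemma measure_forall_block_mem [IsProbabilityMeasure P] {D : ℕ → Ω → ℝ} (hD : iIndepFun D P)
    (hm : ∀ k, Measurable (D k)) (M : ℕ) {B : ℕ → Set (Fin M → ℝ)}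
    (hB : ∀ i, MeasurableSet (B i)) (n : ℕ) :
    P {ω | ∀ i < n, (fun l : Fin M ↦ D (i * M + l) ω) ∈ B i} =
      ∏ i ∈ Finset.range n, P {ω | (fun l : Fin M ↦ D (i * M + l) ω) ∈ B i} := by
  induction n with
  | zero => simp
  | succ n ih =>
    have hind := hD.indepFun_finset (Finset.range (n * M)) (Finset.Ico (n * M) ((n + 1) * M))
      (by
        rw [Finset.disjoint_left]
        intro k hk hk'
        rw [Finset.mem_range] at hk
        rw [Finset.mem_Ico] at hk'
        omega) hm
    have hlt : ∀ i < n, ∀ l : Fin M, i * M + l < n * M := fun i hi l ↦ by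
      have := l.2
      nlinarith
    have hIco : ∀ l : Fin M, n * M + l ∈ Finset.Ico (n * M) ((n + 1) * M) := fun l ↦ by
      have := l.2
      rw [Finset.mem_Ico]
      constructor <;> nlinarith
    let S : Set (Finset.range (n * M) → ℝ) := ⋂ (i : ℕ) (hi : i < n),
      {e | (fun l : Fin M ↦ e ⟨i * M + l, Finset.mem_range.2 (hlt i hi l)⟩) ∈ B i}
    let T : Set (Finset.Ico (n * M) ((n + 1) * M) → ℝ) :=
      {e | (fun l : Fin M ↦ e ⟨n * M + l, hIco l⟩) ∈ B n}
    have hS : MeasurableSet S := MeasurableSet.iInter fun i ↦ MeasurableSet.iInter fun hi ↦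
      measurableSet_preimage (by fun_prop) (hB i)
    have hT : MeasurableSet T := measurableSet_preimage (by fun_prop) (hB n)
    have key := hind.measure_inter_preimage_eq_mul S T hS hT
    rw [Finset.prod_range_succ, ← ih]
    convert! key using 2
    · ext ω
      simp only [S, T, Set.mem_ofPred_eq, Set.mem_inter_iff, Set.mem_preimage, Set.mem_iInter,
        Nat.lt_succ_iff_lt_or_eq]
      constructor
      · exact fun h ↦ ⟨fun i hi ↦ h i (.inl hi), h n (.inr rfl)⟩
      · rintro ⟨h1, h2⟩ i (hi | rfl)
        exacts [h1 i hi, h2]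
    · congr 1
      ext ω
      simp [S]

variable {ν : Measure ℝ}

open Classical in
/-- A lower bound for the probability that a compound Poisson process on a unit interval is
constant or, respectively, has exactly one jump, with size in `U`. -/
noncomputable def stepBound (ν : Measure ℝ) (U : Set ℝ) : ℝ≥0∞ :=
  ENNReal.ofReal (Real.exp (-ν.real Set.univ)) * if (0 : ℝ) ∈ U then 1 else ν U

lemma stepBound_ne_zero {U : Set ℝ} (h : (0 : ℝ) ∈ U ∨ ν U ≠ 0) : stepBound ν U ≠ 0 := by
  unfold stepBound
  refine mul_ne_zero (by simpa using Real.exp_pos _) ?_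
  split_ifs with h0
  · exact one_ne_zero
  · exact h.resolve_left h0

/-- Cut the unit interval into `M` cells. Each cell is jumpless with probability at least `p`, where
`p ^ M = exp (-ν(ℝ))`, and has increment in `U` with probability at least `p * ν U / M`. The `M`
choices of the jumping cell cancel the `1 / M`, so the bound does not depend on `M`. -/
lemma stepBound_le [IsFiniteMeasure ν] {M : ℕ} (hM : 0 < M) {D : Fin M → Ω → ℝ}
    (hD : iIndepFun D P) (hm : ∀ l, Measurable (D l))
    (hlaw : ∀ l, P.map (D l) = cpLaw ν (M : ℝ≥0)⁻¹) {U : Set ℝ} (hU : MeasurableSet U) :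
    stepBound ν U ≤ P {ω | ∃ j, D j ω ∈ U ∧ ∀ l ≠ j, D l ω = 0} := by
  classical
  set p := ENNReal.ofReal (Real.exp (-(((M : ℝ≥0)⁻¹ : ℝ≥0) * ν.real Set.univ))) with hp
  have hM0 : (M : ℝ) ≠ 0 := by exact_mod_cast hM.ne'
  have hpM : p ^ M = ENNReal.ofReal (Real.exp (-ν.real Set.univ)) := by
    rw [hp, ← ENNReal.ofReal_pow (Real.exp_pos _).le, ← Real.exp_nat_mul]
    congr 2
    push_cast
    field_simp
  have hzero : ∀ l, p ≤ P (D l ⁻¹' {0}) := fun l ↦ by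
    rw [← Measure.map_apply (hm l) (measurableSet_singleton _), hlaw]
    exact le_cpLaw_singleton_zero _ _
  have hjump : ∀ l, p * (((M : ℝ≥0)⁻¹ : ℝ≥0) * ν U) ≤ P (D l ⁻¹' U) := fun l ↦ by
    rw [← Measure.map_apply (hm l) hU, hlaw]
    exact le_cpLaw _ _ _
  by_cases h0 : (0 : ℝ) ∈ U
  · rw [stepBound, if_pos h0, mul_one, ← hpM]
    calc p ^ M = ∏ l : Fin M, p := by simp
      _ ≤ ∏ l : Fin M, P (D l ⁻¹' {0}) := Finset.prod_le_prod' fun l _ ↦ hzero l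
      _ = P (⋂ l, D l ⁻¹' {0}) :=
        (hD.meas_iInter fun l ↦ ⟨{0}, measurableSet_singleton _, rfl⟩).symm
      _ ≤ _ := by
        refine measure_mono fun ω hω ↦ ?_
        simp only [Set.mem_iInter, Set.mem_preimage, Set.mem_singleton_iff] at hω
        exact ⟨⟨0, hM⟩, by rwa [hω], fun l _ ↦ hω l⟩
  · let S : Fin M → Fin M → Set ℝ := fun j l ↦ if l = j then U else {0}
    have hS : ∀ j l, MeasurableSet (S j l) := fun j l ↦ by
      dsimp only [S]
      split_ifs
      exacts [hU, measurableSet_singleton _]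
    have hE : ∀ j, p ^ M * (((M : ℝ≥0)⁻¹ : ℝ≥0) * ν U) ≤ P (⋂ l, D l ⁻¹' S j l) := fun j ↦ by
      rw [hD.meas_iInter fun l ↦ ⟨S j l, hS j l, rfl⟩]
      calc p ^ M * (((M : ℝ≥0)⁻¹ : ℝ≥0) * ν U)
          = ∏ l : Fin M, p * if l = j then (((M : ℝ≥0)⁻¹ : ℝ≥0) * ν U) else 1 := by
            rw [Finset.prod_mul_distrib, Finset.prod_ite_eq' Finset.univ j]
            simp
        _ ≤ _ := Finset.prod_le_prod' fun l _ ↦ by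
            dsimp only [S]
            split_ifs with h
            · exact hjump l
            · rw [mul_one]; exact hzero l
    -- Since `0 ∉ U`, the jumping cell is determined by the increments.
    have hdisj : Pairwise (Function.onFun Disjoint fun j ↦ ⋂ l, D l ⁻¹' S j l) := by
      intro j j' hjj'
      rw [Function.onFun, Set.disjoint_left]
      intro ω h1 h2
      have a1 := Set.mem_iInter.1 h1 j
      have a2 := Set.mem_iInter.1 h2 j
      simp only [S, if_true, if_neg hjj', Set.mem_preimage, Set.mem_singleton_iff] at a1 a2
      exact h0 (a2 ▸ a1)
    rw [stepBound, if_neg h0, ← hpM]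
    calc p ^ M * ν U = ∑ j : Fin M, p ^ M * (((M : ℝ≥0)⁻¹ : ℝ≥0) * ν U) := by
          rw [Finset.sum_const, Finset.card_univ, Fintype.card_fin, nsmul_eq_mul,
            mul_left_comm, ← mul_assoc (M : ℝ≥0∞)]
          have : (M : ℝ≥0∞) * ((M : ℝ≥0)⁻¹ : ℝ≥0) = 1 := by
            have h : (M : ℝ≥0) * (M : ℝ≥0)⁻¹ = 1 := mul_inv_cancel₀ (by exact_mod_cast hM.ne')
            exact_mod_cast congrArg ((↑) : ℝ≥0 → ℝ≥0∞) h
          rw [this, one_mul]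
      _ ≤ ∑ j : Fin M, P (⋂ l, D l ⁻¹' S j l) := Finset.sum_le_sum fun j _ ↦ hE j
      _ = P (⋃ j, ⋂ l, D l ⁻¹' S j l) := by
          rw [measure_iUnion hdisj fun j ↦ MeasurableSet.iInter fun l ↦ hm l (hS j l), tsum_fintype]
      _ ≤ _ := by
          refine measure_mono (Set.iUnion_subset fun j ω hω ↦ ⟨j, ?_, fun l hl ↦ ?_⟩)
          · simpa [S] using Set.mem_iInter.1 hω j
          · simpa [S, hl] using Set.mem_iInter.1 hω l

variable [IsProbabilityMeasure P] {X : ℝ≥0 → Ω → ℝ}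

lemma IsCompoundPoisson.prod_stepBound_le (h : IsCompoundPoisson X ν P) {U : ℕ → Set ℝ}
    (hU : ∀ i, MeasurableSet (U i)) (m n : ℕ) :
    ∏ i ∈ Finset.range n, stepBound ν (U i) ≤
      P {ω | ∀ i < n, DyadicStep m i (U i) fun t ↦ X t ω} := by
  have := h.finite
  set D : ℕ → Ω → ℝ := fun k ω ↦ X (dyadic m (k + 1)) ω - X (dyadic m k) ω with hDdef
  have hD : iIndepFun D P := h.isLevy.indep_increments.nat (dyadic_mono m)
  have hm : ∀ k, Measurable (D k) := fun k ↦ (h.isLevy.measurable _).sub (h.isLevy.measurable _)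
  have hlaw : ∀ k, P.map (D k) = cpLaw ν ((2 ^ m : ℕ) : ℝ≥0)⁻¹ := fun k ↦ by
    rw [← h.map_eq, ← (h.isLevy.stationary_increments (dyadic m k) _).map_eq]
    have : dyadic m (k + 1) = dyadic m k + ((2 ^ m : ℕ) : ℝ≥0)⁻¹ := by
      simp only [dyadic]
      push_cast
      rw [add_div, one_div]
    simp only [hDdef, this]
  let B : ℕ → Set (Fin (2 ^ m) → ℝ) := fun i ↦ {d | ∃ j, d j ∈ U i ∧ ∀ l ≠ j, d l = 0}
  have hB : ∀ i, MeasurableSet (B i) := fun i ↦ by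
    simp only [B, Set.ofPred_exists, Set.ofPred_and, Set.ofPred_forall]
    refine MeasurableSet.iUnion fun j ↦ ((measurable_pi_apply j) (hU i)).inter
      (MeasurableSet.iInter fun l ↦ MeasurableSet.iInter fun _ ↦
        (measurable_pi_apply l) (measurableSet_singleton 0))
  calc ∏ i ∈ Finset.range n, stepBound ν (U i)
      ≤ ∏ i ∈ Finset.range n, P {ω | (fun l : Fin (2 ^ m) ↦ D (i * 2 ^ m + l) ω) ∈ B i} := by
        refine Finset.prod_le_prod' fun i _ ↦ ?_
        refine stepBound_le (D := fun (l : Fin (2 ^ m)) ω ↦ D (i * 2 ^ m + l) ω)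
          (Nat.two_pow_pos m) (hD.precomp (g := fun l : Fin (2 ^ m) ↦ i * 2 ^ m + l) ?_)
          (fun l ↦ hm _) (fun l ↦ hlaw _) (hU i)
        intro a b hab
        exact Fin.ext (Nat.add_left_cancel hab)
    _ = P {ω | ∀ i < n, (fun l : Fin (2 ^ m) ↦ D (i * 2 ^ m + l) ω) ∈ B i} :=
        (measure_forall_block_mem hD hm _ hB n).symm
    _ ≤ _ := by
        refine measure_mono fun ω hω i hi ↦ ?_
        obtain ⟨j, hj, hl⟩ := hω i hi
        exact dyadicStep_of_forall_eq j.2 hj fun l hlt hne ↦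
          hl ⟨l, hlt⟩ fun hc ↦ hne (congrArg Fin.val hc)

/-- A compound Poisson process follows any prescribed pattern of steps with positive
probability. -/
lemma IsCompoundPoisson.measure_forall_dyadicStep_ne_zero (h : IsCompoundPoisson X ν P)
    {U : ℕ → Set ℝ} (hU : ∀ i, MeasurableSet (U i)) (hpos : ∀ i, (0 : ℝ) ∈ U i ∨ ν (U i) ≠ 0)
    (n : ℕ) : P {ω | ∀ m, ∀ i < n, DyadicStep m i (U i) fun t ↦ X t ω} ≠ 0 := by
  have hX : Measurable fun ω t ↦ X t ω := measurable_pi_lambda _ h.isLevy.measurable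
  have hmeas : ∀ m, MeasurableSet {ω | ∀ i < n, DyadicStep m i (U i) fun t ↦ X t ω} := fun m ↦ by
    simp only [Set.ofPred_forall]
    exact MeasurableSet.iInter fun i ↦ MeasurableSet.iInter fun _ ↦
      hX (measurableSet_dyadicStep m i (hU i))
  have hanti : Antitone fun m ↦ {ω | ∀ i < n, DyadicStep m i (U i) fun t ↦ X t ω} :=
    fun a b hab ω hω i hi ↦ antitone_dyadicStep i (U i) _ hab (hω i hi)
  -- The events decrease in `m` under a bound free of `m`, so continuity from above applies.
  have hle : ∏ i ∈ Finset.range n, stepBound ν (U i) ≤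
      P (⋂ m, {ω | ∀ i < n, DyadicStep m i (U i) fun t ↦ X t ω}) := by
    rw [hanti.measure_iInter (fun m ↦ (hmeas m).nullMeasurableSet) ⟨0, measure_ne_top _ _⟩]
    exact le_iInf fun m ↦ h.prod_stepBound_le hU m n
  rw [Set.ofPred_forall]
  exact fun hc ↦ (Finset.prod_ne_zero_iff.2 fun i _ ↦ stepBound_ne_zero (hpos i))
    (nonpos_iff_eq_zero.1 (hle.trans hc.le))

end

end KilledExp

/-! ### From jump patterns to the support of the functional -/

namespace KilledExp

/-- The values of the exponential functional along the pairs of paths which make finitely many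
jumps, one at a time, with sizes in `B` for the exponent and in `A` for the integrator. -/
def jumpValues (A B : Set ℝ) : Set ℝ :=
  {v | ∃ (n : ℕ) (a b : ℕ → ℝ),
    (∀ i, (a i = 0 ∨ a i ∈ A) ∧ (b i = 0 ∨ b i ∈ B) ∧ (a i = 0 ∨ b i = 0)) ∧ a n = 0 ∧ b n = 0 ∧
    ∑ i ∈ Finset.range n, Real.exp (-∑ j ∈ Finset.range i, b j) * a i = v}

/-- Both operations prepend one interval to the pattern: an `η`-jump at exponent `0` adds `z`, a
`ξ`-jump rescales every later term by `exp (-x)`. -/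
lemma isStable_jumpValues (A B : Set ℝ) : IsStable A B (jumpValues A B) where
  zero_mem := ⟨0, 0, 0, by simp⟩
  add_mem := by
    rintro z hz _ ⟨n, a, b, hab, ha, hb, rfl⟩
    refine ⟨n + 1, fun i ↦ Nat.casesOn i z a, fun i ↦ Nat.casesOn i 0 b, fun i ↦ ?_, ha, hb, ?_⟩
    · cases i with
      | zero => exact ⟨.inr hz, .inl rfl, .inr rfl⟩
      | succ i => exact hab i
    · rw [Finset.sum_range_succ']
      simp [Finset.sum_range_succ', add_comm]
  exp_mul_mem := by
    rintro x hx _ ⟨n, a, b, hab, ha, hb, rfl⟩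
    refine ⟨n + 1, fun i ↦ Nat.casesOn i 0 a, fun i ↦ Nat.casesOn i x b, fun i ↦ ?_, ha, hb, ?_⟩
    · cases i with
      | zero => exact ⟨.inl rfl, .inr hx, .inl rfl⟩
      | succ i => exact hab i
    · rw [Finset.sum_range_succ', Finset.mul_sum]
      simp [Finset.sum_range_succ', Real.exp_add, mul_left_comm, mul_comm]

lemma IsStable.closure {A B C : Set ℝ} (h : IsStable A B C) : IsStable A B (closure C) where
  zero_mem := subset_closure h.zero_mem
  add_mem z hz _ hv := map_mem_closure (by fun_prop) hv (h.add_mem z hz)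
  exp_mul_mem x hx _ hv := map_mem_closure (by fun_prop) hv (h.exp_mul_mem x hx)

lemma exists_forall_abs_sum_exp_mul_sub_lt (n : ℕ) (a b : ℕ → ℝ) {δ : ℝ} (hδ : 0 < δ) :
    ∃ ε > 0, ∀ x y : ℕ → ℝ, (∀ i < n, |x i - b i| < ε) → (∀ i < n, |y i - a i| < ε) →
      |∑ i ∈ Finset.range n, Real.exp (-∑ j ∈ Finset.range i, x j) * y i -
        ∑ i ∈ Finset.range n, Real.exp (-∑ j ∈ Finset.range i, b j) * a i| < δ := by
  -- Only the first `n` coordinates matter; on a finite product, continuity in the sup metric yields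
  -- one `ε` for all of them.
  let F : (Fin n → ℝ) × (Fin n → ℝ) → ℝ := fun p ↦ ∑ i : Fin n,
    Real.exp (-∑ j ∈ Finset.univ.filter (· < i), p.1 j) * p.2 i
  have hF : Continuous F := by fun_prop
  have hFeq : ∀ x y : ℕ → ℝ, ∑ i ∈ Finset.range n, Real.exp (-∑ j ∈ Finset.range i, x j) * y i =
      F (fun i ↦ x i, fun i ↦ y i) := fun x y ↦ by
    simp only [F]
    rw [Finset.sum_range]
    refine Finset.sum_congr rfl fun i _ ↦ ?_
    congr 3
    refine (Finset.sum_bij (fun (j : Fin n) _ ↦ (j : ℕ)) ?_ ?_ ?_ ?_).symm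
    · intro j hj
      exact Finset.mem_range.2 (Finset.mem_filter.1 hj).2
    · intro j _ j' _ h
      exact Fin.ext h
    · intro j hj
      rw [Finset.mem_range] at hj
      exact ⟨⟨j, hj.trans i.2⟩, Finset.mem_filter.2 ⟨Finset.mem_univ _, hj⟩, rfl⟩
    · intro j _
      rfl
  obtain ⟨ε, hε, h⟩ := Metric.continuous_iff.1 hF (fun i ↦ b i, fun i ↦ a i) δ hδ
  refine ⟨ε, hε, fun x y hx hy ↦ ?_⟩
  rw [hFeq, hFeq, ← Real.dist_eq]
  refine h _ (max_lt ?_ ?_)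
  · exact (dist_pi_lt_iff hε).2 fun i ↦ hx i i.2
  · exact (dist_pi_lt_iff hε).2 fun i ↦ hy i i.2

/-- A punctured ball around a nonzero jump size, or `{0}`. -/
def jumpNhd (c ε : ℝ) : Set ℝ := {w | |w - c| < ε ∧ (w = 0 ↔ c = 0)}

lemma measurableSet_jumpNhd (c ε : ℝ) : MeasurableSet (jumpNhd c ε) := by
  have h1 : MeasurableSet {w : ℝ | |w - c| < ε} := measurableSet_lt (by fun_prop) (by fun_prop)
  refine h1.inter ?_
  by_cases hc : c = 0
  · simp only [hc, iff_true]
    exact measurableSet_singleton 0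
  · simp only [hc, iff_false]
    exact (measurableSet_singleton 0).compl

/-- As `ν {0} = 0`, removing `0` from a ball costs no mass. -/
lemma jumpNhd_pos {ν : Measure ℝ} (h0 : ν {0} = 0) {c ε : ℝ} (hε : 0 < ε)
    (hc : c = 0 ∨ c ∈ ν.support) : (0 : ℝ) ∈ jumpNhd c ε ∨ ν (jumpNhd c ε) ≠ 0 := by
  by_cases hc0 : c = 0
  · exact .inl (by simp [jumpNhd, hc0, hε])
  · have := (Measure.mem_support_iff_forall c).1 (hc.resolve_left hc0) _ (Metric.ball_mem_nhds c hε)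
    rw [← measure_sdiff_null h0] at this
    refine .inr (ne_of_gt (this.trans_le (measure_mono fun w hw ↦ ?_)))
    exact ⟨by simpa [Real.dist_eq] using hw.1, by simpa [hc0] using hw.2⟩

lemma expMeasure_Icc_pos {q : ℝ} (hq : 0 < q) (n : ℕ) :
    expMeasure q (Set.Icc (n : ℝ) (n + 1)) ≠ 0 := by
  have := isProbabilityMeasure_expMeasure hq
  have h1 : expMeasure q (Set.Ioc (n : ℝ) (n + 1)) ≠ 0 := by
    rw [← measure_cdf (expMeasure q), StieltjesFunction.measure_Ioc, cdf_expMeasure_eq hq,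
      cdf_expMeasure_eq hq, if_pos (by positivity), if_pos (by positivity)]
    have : Real.exp (-(q * (n + 1))) < Real.exp (-(q * n)) := Real.exp_lt_exp.2 (by linarith)
    simpa using this
  exact fun h ↦ h1 (measure_mono_null Set.Ioc_subset_Icc_self h)

section

lemma IsLevyProcess.neg {Ω : Type*} [MeasurableSpace Ω] {P : Measure Ω} {X : ℝ≥0 → Ω → ℝ}
    (h : IsLevyProcess X P) :
    IsLevyProcess (fun t ω ↦ -X t ω) P where
  measurable t := (h.measurable t).neg
  start_zero := by filter_upwards [h.start_zero] with ω hω using by rw [hω, neg_zero]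
  indep_increments := by
    simpa using h.indep_increments.smul (-1 : ℝ)
  stationary_increments s t := by
    convert! (h.stationary_increments s t).comp measurable_neg using 1
    ext ω
    simp only [Function.comp_apply]
    ring
  cadlag := by
    filter_upwards [h.cadlag] with ω hω t
    exact ⟨(hω t).1.neg, (hω t).2.imp' _ fun l hl ↦ hl.neg⟩

variable {Ω : Type*} [MeasurableSpace Ω] {P : Measure Ω} [IsProbabilityMeasure P]
  {ξ η X : ℝ≥0 → Ω → ℝ} {νξ νη ν : Measure ℝ} {q : ℝ} {τ : Ω → ℝ≥0} {V : Ω → ℝ}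

/-- Three independent events of positive probability, `ξ` following `b`, `η` following `a` and `τ ∈
[n, n + 1]`, together force `V` into the given neighbourhood. -/
lemma jumpValues_subset_rvSupport (hξ : IsCompoundPoisson ξ νξ P) (hη : IsCompoundPoisson η νη P)
    (hq : 0 < q) (hτ : Measurable τ) (hτ_law : P.map (fun ω ↦ (τ ω : ℝ)) = expMeasure q)
    (h_indep : IndepFun (fun ω t ↦ ξ t ω) (fun ω t ↦ η t ω) P)
    (h_indep_τ : IndepFun (fun ω ↦ ((fun t ↦ ξ t ω), (fun t ↦ η t ω))) τ P)
    (hV : IsKilledExpFunctional V ξ η τ P) :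
    jumpValues νη.support νξ.support ⊆ rvSupport V P := by
  rintro _ ⟨n, a, b, hab, han, hbn, rfl⟩
  set v := ∑ i ∈ Finset.range n, Real.exp (-∑ j ∈ Finset.range i, b j) * a i
  refine (Measure.mem_support_iff_forall v).2 fun W hW ↦ ?_
  obtain ⟨δ, hδ, hδW⟩ := Metric.mem_nhds_iff.1 hW
  obtain ⟨ε, hε, hclose⟩ := exists_forall_abs_sum_exp_mul_sub_lt n a b hδ
  -- The pattern is imposed on `n + 1` intervals: the last one is idle, so the place of `τ` inside
  -- it is irrelevant.
  let E : (ℕ → ℝ) → Set (ℝ≥0 → ℝ) := fun c ↦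
    {f | ∀ m, ∀ i < n + 1, DyadicStep m i (jumpNhd (c i) ε) f}
  have hE : ∀ c, MeasurableSet (E c) := fun c ↦ by
    simp only [E, Set.ofPred_forall]
    exact MeasurableSet.iInter fun m ↦ MeasurableSet.iInter fun i ↦ MeasurableSet.iInter fun _ ↦
      measurableSet_dyadicStep m i (measurableSet_jumpNhd _ _)
  have h1 : P ((fun ω t ↦ ξ t ω) ⁻¹' E b) ≠ 0 :=
    hξ.measure_forall_dyadicStep_ne_zero (fun i ↦ measurableSet_jumpNhd (b i) ε)
      (fun i ↦ jumpNhd_pos hξ.zero_null hε (hab i).2.1) (n + 1)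
  have h2 : P ((fun ω t ↦ η t ω) ⁻¹' E a) ≠ 0 :=
    hη.measure_forall_dyadicStep_ne_zero (fun i ↦ measurableSet_jumpNhd (a i) ε)
      (fun i ↦ jumpNhd_pos hη.zero_null hε (hab i).1) (n + 1)
  have h3 : P (τ ⁻¹' Set.Icc (n : ℝ≥0) (n + 1)) ≠ 0 := by
    have := expMeasure_Icc_pos hq n
    rw [← hτ_law, Measure.map_apply (by fun_prop) measurableSet_Icc] at this
    convert! this using 2
  have h12 := h_indep.measure_inter_preimage_eq_mul _ _ (hE b) (hE a)
  have h123 := h_indep_τ.measure_inter_preimage_eq_mul _ _ ((hE b).prod (hE a))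
    (measurableSet_Icc (a := (n : ℝ≥0)) (b := n + 1))
  have h12' : (fun ω ↦ ((fun t ↦ ξ t ω), (fun t ↦ η t ω))) ⁻¹' (E b ×ˢ E a) =
    (fun ω t ↦ ξ t ω) ⁻¹' E b ∩ (fun ω t ↦ η t ω) ⁻¹' E a := rfl
  have hpos := mul_ne_zero (mul_ne_zero h1 h2) h3
  rw [← h12, ← h12', ← h123] at hpos
  refine lt_of_lt_of_le ?_ (measure_mono hδW)
  rw [Measure.map_apply_of_aemeasurable hV.aemeasurable measurableSet_ball]
  refine (pos_iff_ne_zero.2 hpos).trans_le (measure_mono_ae ?_)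
  filter_upwards [hV.ae_eq, hξ.isLevy.start_zero, hξ.isLevy.cadlag, hη.isLevy.cadlag]
    with ω hVω hξ0 hξc hηc
  rintro ⟨⟨hEb, hEa⟩, hτn⟩
  change ∀ m, ∀ i < n + 1, DyadicStep m i (jumpNhd (b i) ε) (fun t ↦ ξ t ω) at hEb
  change ∀ m, ∀ i < n + 1, DyadicStep m i (jumpNhd (a i) ε) (fun t ↦ η t ω) at hEa
  change V ω ∈ Metric.ball v δ
  have hb : ∀ i < n + 1, ξ (i + 1) ω - ξ i ω ∈ jumpNhd (b i) ε := fun i hi ↦ (hEb 0 i hi).1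
  have ha : ∀ i < n + 1, η (i + 1) ω - η i ω ∈ jumpNhd (a i) ε := fun i hi ↦ (hEa 0 i hi).1
  have hξsum : ∀ i : ℕ, ξ i ω = ∑ j ∈ Finset.range i, (ξ (j + 1) ω - ξ j ω) := fun i ↦ by
    have := Finset.sum_range_sub (fun j : ℕ ↦ ξ j ω) i
    push_cast at this
    rw [this, hξ0, sub_zero]
  rw [hVω, Metric.mem_ball, Real.dist_eq, expIntegral_eq_sum hηc (n := n)
    (fun i hi ↦ hξc.isStepOn fun m ↦ hEb m i (Nat.lt_succ_of_le hi))
    (fun i hi ↦ hηc.isStepOn fun m ↦ hEa m i (Nat.lt_succ_of_le hi))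
    (fun i hi ↦ ?_) (sub_eq_zero.1 ((ha n n.lt_succ_self).2.2 han)) hτn.1 hτn.2]
  · have hsum : ∑ i ∈ Finset.range n, Real.exp (-ξ i ω) * (η (i + 1) ω - η i ω) =
        ∑ i ∈ Finset.range n, Real.exp (-∑ j ∈ Finset.range i, (ξ (j + 1) ω - ξ j ω)) *
          (η (i + 1) ω - η i ω) := Finset.sum_congr rfl fun i _ ↦ by rw [← hξsum i]
    rw [hsum]
    exact hclose (fun i ↦ ξ (i + 1) ω - ξ i ω) (fun i ↦ η (i + 1) ω - η i ω)
      (fun i hi ↦ (hb i (hi.trans n.lt_succ_self)).1) fun i hi ↦ (ha i (hi.trans n.lt_succ_self)).1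
  · refine (hab i).2.2.symm.imp (fun h ↦ ?_) fun h ↦ ?_
    · exact sub_eq_zero.1 ((hb i (hi.trans n.lt_succ_self)).2.2 h)
    · exact sub_eq_zero.1 ((ha i (hi.trans n.lt_succ_self)).2.2 h)

/-! ### Increments of compound Poisson paths and the sign of their jumps -/

/-- If the jumps of a compound Poisson process lie in a closed additive submonoid, then so do
almost surely all its increments. -/
lemma IsCompoundPoisson.ae_sub_mem (h : IsCompoundPoisson X ν P) {C : Set ℝ} (hC : IsClosed C)
    (h0 : (0 : ℝ) ∈ C) (hadd : ∀ x ∈ C, ∀ y ∈ C, x + y ∈ C) (hν : ν Cᶜ = 0) :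
    ∀ᵐ ω ∂P, ∀ s t, s ≤ t → X t ω - X s ω ∈ C := by
  have := h.finite
  -- Countably many dyadic pairs share one null set; right-continuity and closedness of `C` then
  -- reach all times.
  have hdy : ∀ᵐ ω ∂P, ∀ m k l : ℕ, k ≤ l → X (dyadic m l) ω - X (dyadic m k) ω ∈ C := by
    simp only [ae_all_iff]
    intro m k l hkl
    have hid := h.isLevy.stationary_increments (dyadic m k) (dyadic m l - dyadic m k)
    rw [add_tsub_cancel_of_le (dyadic_mono m hkl)] at hid
    rw [ae_iff]
    have := cpLaw_compl_eq_zero ν hC.measurableSet h0 hadd hν (dyadic m l - dyadic m k)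
    rw [← h.map_eq, ← hid.map_eq, Measure.map_apply_of_aemeasurable
      hid.aemeasurable_fst hC.measurableSet.compl] at this
    exact this
  filter_upwards [hdy, h.isLevy.cadlag] with ω hω hc s t hst
  refine hC.mem_of_tendsto ((hc.tendsto_dyadic t).sub (hc.tendsto_dyadic s))
    (.of_forall fun m ↦ hω m _ _ ?_)
  gcongr

/-- Used by contraposition: a process that is not a subordinator must have negative jumps. -/
lemma IsCompoundPoisson.isSubordinator (h : IsCompoundPoisson X ν P) (hν : ν (Set.Iio 0) = 0) :
    IsSubordinator X P := by
  refine ⟨h.isLevy, ?_⟩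
  filter_upwards [h.ae_sub_mem (C := Set.Ici 0) isClosed_Ici (by simp)
    (fun x hx y hy ↦ Set.mem_Ici.2 (add_nonneg hx hy)) (by rwa [Set.compl_Ici])] with ω hω s t hst
  exact sub_nonneg.1 (hω s t hst)

lemma IsCompoundPoisson.isSubordinator_neg (h : IsCompoundPoisson X ν P)
    (hν : ν (Set.Ioi 0) = 0) : IsSubordinator (fun t ω ↦ -X t ω) P := by
  refine ⟨h.isLevy.neg, ?_⟩
  filter_upwards [h.ae_sub_mem (C := Set.Iic 0) isClosed_Iic (by simp)
    (fun x hx y hy ↦ Set.mem_Iic.2 (add_nonpos hx hy)) (by rwa [Set.compl_Iic])] with ω hω s t hst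
  exact neg_le_neg (sub_nonpos.1 (hω s t hst))

/-- The law at time `1` dominates a positive multiple of `ν`. -/
lemma IsCompoundPoisson.measure_eq_zero (h : IsCompoundPoisson X ν P) {U : Set ℝ}
    (hU : MeasurableSet U) (hX : P (X 1 ⁻¹' U) = 0) : ν U = 0 := by
  have := h.finite
  rw [← Measure.map_apply (h.isLevy.measurable 1) hU, h.map_eq] at hX
  have := le_cpLaw ν 1 U
  rw [hX] at this
  simpa [(Real.exp_pos _).not_ge] using this

lemma IsCompoundPoisson.support_subset_Ici (h : IsCompoundPoisson X ν P)
    (hs : IsSubordinator X P) : ν.support ⊆ Set.Ici 0 := by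
  refine Measure.support_subset_of_isClosed isClosed_Ici ?_
  rw [mem_ae_iff, Set.compl_Ici]
  refine h.measure_eq_zero measurableSet_Iio (measure_eq_zero_iff_ae_notMem.2 ?_)
  filter_upwards [hs.monotone, h.isLevy.start_zero] with ω hω h0
  have := hω (zero_le : (0 : ℝ≥0) ≤ 1)
  simp only [h0] at this
  simpa using this

lemma IsCompoundPoisson.support_subset_Iic (h : IsCompoundPoisson X ν P)
    (hs : IsSubordinator (fun t ω ↦ -X t ω) P) : ν.support ⊆ Set.Iic 0 := by
  refine Measure.support_subset_of_isClosed isClosed_Iic ?_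
  rw [mem_ae_iff, Set.compl_Iic]
  refine h.measure_eq_zero measurableSet_Ioi (measure_eq_zero_iff_ae_notMem.2 ?_)
  filter_upwards [hs.monotone, h.isLevy.start_zero] with ω hω h0
  have := hω (zero_le : (0 : ℝ≥0) ≤ 1)
  simp only [h0] at this
  simpa using this

/-- Almost surely all increments from time `0` lie in the closed additive monoid generated by
`ν.support`, whatever the random time, and a closed stable set contains this monoid. -/
lemma IsCompoundPoisson.rvSupport_subset (h : IsCompoundPoisson X ν P) (τ : Ω → ℝ≥0)
    {B C : Set ℝ} (hC : IsStable ν.support B C) (hCc : IsClosed C) :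
    rvSupport (fun ω ↦ X (τ ω) ω) P ⊆ C := by
  set T := (AddSubmonoid.closure ν.support).topologicalClosure
  have hTc : IsClosed (T : Set ℝ) := AddSubmonoid.isClosed_topologicalClosure _
  have hsub : ν.support ⊆ T :=
    AddSubmonoid.subset_closure.trans (AddSubmonoid.le_topologicalClosure _)
  have hTC : (T : Set ℝ) ⊆ C := by
    refine closure_minimal (fun x hx ↦ ?_) hCc
    induction hx using AddSubmonoid.closure_induction_left with
    | zero => exact hC.zero_mem
    | add_left z hz y _ ih => exact hC.add_mem z hz y ih
  refine Set.Subset.trans (Measure.support_subset_of_isClosed hTc ?_) hTC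
  -- If measurability fails, `Measure.map` is zero by convention and its support is empty.
  by_cases hm : AEMeasurable (fun ω ↦ X (τ ω) ω) P
  · rw [mem_ae_map_iff hm hTc.measurableSet]
    filter_upwards [h.isLevy.start_zero, h.ae_sub_mem hTc T.zero_mem
      (fun x hx y hy ↦ T.add_mem hx hy)
      (measure_mono_null (Set.compl_subset_compl.2 hsub) Measure.measure_compl_support)]
      with ω h0 hω
    have := hω 0 (τ ω) zero_le
    rwa [h0, sub_zero] at this
  · simp [Measure.map_of_not_aemeasurable hm]

lemma exists_mem_support_neg (h0 : (0 : ℝ) ∉ ν.support) (h : ν (Set.Iic 0) ≠ 0) :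
    ∃ z ∈ ν.support, z < 0 := by
  obtain ⟨z, hz, hzs⟩ := Measure.nonempty_inter_support_of_pos (pos_iff_ne_zero.2 h)
  exact ⟨z, hzs, lt_of_le_of_ne hz fun hc ↦ h0 (hc ▸ hzs)⟩

lemma exists_mem_support_pos (h0 : (0 : ℝ) ∉ ν.support) (h : ν (Set.Ici 0) ≠ 0) :
    ∃ z ∈ ν.support, 0 < z := by
  obtain ⟨z, hz, hzs⟩ := Measure.nonempty_inter_support_of_pos (pos_iff_ne_zero.2 h)
  exact ⟨z, hzs, lt_of_le_of_ne hz fun hc ↦ h0 (hc ▸ hzs)⟩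

end

end KilledExp

/-! ### The five claims, read off the stable set -/

theorem mainTheorem11 {Ω : Type*} [MeasurableSpace Ω] (P : Measure Ω) [IsProbabilityMeasure P]
    (ξ η : ℝ≥0 → Ω → ℝ) (νξ νη : Measure ℝ) (q : ℝ) (τ : Ω → ℝ≥0) (V : Ω → ℝ)
    (hξ : KilledExp.IsCompoundPoisson ξ νξ P) (hη : KilledExp.IsCompoundPoisson η νη P)
    (hq : 0 < q) (hτ : Measurable τ) (hτ_law : P.map (fun ω ↦ (τ ω : ℝ)) = expMeasure q)
    -- `ξ`, `η` and `τ` are independent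
    (h_indep : IndepFun (fun ω t ↦ ξ t ω) (fun ω t ↦ η t ω) P)
    (h_indep_τ : IndepFun (fun ω ↦ ((fun t ↦ ξ t ω), (fun t ↦ η t ω))) τ P)
    (hV : KilledExp.IsKilledExpFunctional V ξ η τ P)
    (h0η : (0 : ℝ) ∉ νη.support) (h0ξ : (0 : ℝ) ∉ νξ.support) (hneg : νξ (Set.Ici 0) = 0) :
    -- an interval in the support of `νξ`
    (∀ α β : ℝ, β < α → α < 0 → Set.Icc β α ⊆ νξ.support →
      ∀ k : ℤ, k = ⌊α / (β - α)⌋ + 1 →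
        (KilledExp.IsSubordinator η P →
          KilledExp.rvSupport (fun ω ↦ η (τ ω) ω) P ∪
            Set.Ici (Real.exp (-(k : ℝ) * α) * sInf νη.support) ⊆ KilledExp.rvSupport V P) ∧
        (KilledExp.IsSubordinator (fun t ω ↦ -η t ω) P →
          KilledExp.rvSupport (fun ω ↦ η (τ ω) ω) P ∪
            Set.Iic (Real.exp (-(k : ℝ) * α) * sSup νη.support) ⊆ KilledExp.rvSupport V P) ∧
        (¬ KilledExp.IsSubordinator η P → ¬ KilledExp.IsSubordinator (fun t ω ↦ -η t ω) P →
          KilledExp.rvSupport V P = Set.univ)) ∧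
    -- `η` a subordinator, an interval in the support of `νη`
    (KilledExp.IsSubordinator η P →
      ∀ α β : ℝ, 0 < α → α < β → Set.Icc α β ⊆ νη.support →
      ∀ k : ℤ, k = ⌊α / (β - α)⌋ + 1 →
        (-sSup νξ.support ≤ Real.log (β / α) →
          {0} ∪ Set.Ici α ⊆ KilledExp.rvSupport V P) ∧
        (¬ -sSup νξ.support ≤ Real.log (β / α) →
          {0} ∪ (⋃ l ∈ Set.Icc (1 : ℤ) (k - 1), Set.Icc ((l : ℝ) * α) ((l : ℝ) * β)) ∪
            Set.Ici ((k : ℝ) * α) ⊆ KilledExp.rvSupport V P)) ∧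
    -- `-η` a subordinator, an interval in the support of `νη`
    (KilledExp.IsSubordinator (fun t ω ↦ -η t ω) P →
      ∀ α β : ℝ, β < α → α < 0 → Set.Icc β α ⊆ νη.support →
      ∀ k : ℤ, k = ⌊α / (β - α)⌋ + 1 →
        (-sSup νξ.support ≤ Real.log (β / α) →
          Set.Iic α ∪ {0} ⊆ KilledExp.rvSupport V P) ∧
        (¬ -sSup νξ.support ≤ Real.log (β / α) →
          Set.Iic ((k : ℝ) * α) ∪
            (⋃ l ∈ Set.Icc (1 : ℤ) (k - 1), Set.Icc ((l : ℝ) * β) ((l : ℝ) * α)) ∪ {0} ⊆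
              KilledExp.rvSupport V P)) ∧
    -- jumps of both signs, an interval in the support of `νη`
    (νη (Set.Iic 0) ≠ 0 → νη (Set.Ici 0) ≠ 0 →
      ((∃ α β : ℝ, 0 < α ∧ α < β ∧ Set.Icc α β ⊆ νη.support) ∨
        (∃ α β : ℝ, β < α ∧ α < 0 ∧ Set.Icc β α ⊆ νη.support)) →
      KilledExp.rvSupport V P = Set.univ) ∧
    -- two jump sizes of opposite signs with irrational ratio
    (∀ z₁ z₂ : ℝ, z₁ < 0 → 0 < z₂ → z₁ ∈ νη.support → z₂ ∈ νη.support →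
      Irrational (z₂ / z₁) → KilledExp.rvSupport V P = Set.univ) := by
  have hS := (KilledExp.isStable_jumpValues νη.support νξ.support).closure
  set C := closure (KilledExp.jumpValues νη.support νξ.support)
  have hCc : IsClosed C := isClosed_closure
  have hCV : C ⊆ KilledExp.rvSupport V P := closure_minimal
    (KilledExp.jumpValues_subset_rvSupport hξ hη hq hτ hτ_law h_indep h_indep_τ hV)
    Measure.isClosed_support
  have huniv : C = Set.univ → KilledExp.rvSupport V P = Set.univ := fun h ↦
    Set.univ_subset_iff.1 (h ▸ hCV)
  -- Reflection reduces claims about negative jumps of `η` to positive ones; the multipliers from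
  -- `νξ` are unchanged.
  have hSn := hS.neg
  have hneu : -C = Set.univ → C = Set.univ := fun h ↦ by rw [← neg_neg C, h, Set.neg_univ]
  have hητ := hη.rvSupport_subset τ hS hCc
  have hB : ∀ x ∈ νξ.support, x < 0 := fun x hx ↦ by
    have : νξ.support ⊆ Set.Iic 0 := Measure.support_subset_of_isClosed isClosed_Iic (by
      rw [mem_ae_iff, Set.compl_Iic]
      exact measure_mono_null Set.Ioi_subset_Ici_self hneg)
    exact lt_of_le_of_ne (this hx) fun hc ↦ h0ξ (hc ▸ hx)
  -- The support is closed and bounded above, so its supremum is itself a jump size; it is negative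
  -- because `0` is excluded.
  have hsup : sSup νξ.support ∈ νξ.support := Measure.isClosed_support.csSup_mem
    (Measure.nonempty_support hξ.ne_zero) ⟨0, fun x hx ↦ (hB x hx).le⟩
  have hpos : KilledExp.IsSubordinator η P → ∀ z ∈ νη.support, 0 < z := fun hs z hz ↦
    lt_of_le_of_ne (hη.support_subset_Ici hs hz) fun hc ↦ h0η (hc ▸ hz)
  have hnegη : KilledExp.IsSubordinator (fun t ω ↦ -η t ω) P → ∀ z ∈ νη.support, z < 0 :=
    fun hs z hz ↦ lt_of_le_of_ne (hη.support_subset_Iic hs hz) fun hc ↦ h0η (hc ▸ hz)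
  have hIccneg : ∀ {α β : ℝ}, Set.Icc β α ⊆ νη.support → Set.Icc (-α) (-β) ⊆ -νη.support :=
    fun h x hx ↦ h ⟨by linarith [hx.2], by linarith [hx.1]⟩
  have hkneg : ∀ {α β : ℝ} {k : ℤ}, k = ⌊α / (β - α)⌋ + 1 → k = ⌊-α / (-β - -α)⌋ + 1 :=
    fun {α β k} h ↦ by rw [h, ← neg_div_neg_eq]; congr 3; ring
  refine ⟨fun α β hβα hα hI k hk ↦ ⟨fun hs ↦ ?_, fun hs ↦ ?_, fun hs hs' ↦ huniv ?_⟩,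
    fun hs α β hα hαβ hI k hk ↦ ⟨fun hl ↦ ?_, fun _ ↦ ?_⟩,
    fun hs α β hβα hα hI k hk ↦ ⟨fun hl ↦ ?_, fun _ ↦ ?_⟩, fun hm hp hI ↦ huniv ?_,
    fun z₁ z₂ hz₁ hz₂ h₁ h₂ hirr ↦ huniv (hS.eq_univ_of_irrational hCc h₁ h₂ hz₁ hz₂ hirr)⟩
  · have hinf : sInf νη.support ∈ νη.support := Measure.isClosed_support.csInf_mem
      (Measure.nonempty_support hη.ne_zero) ⟨0, fun z hz ↦ (hpos hs z hz).le⟩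
    exact (Set.union_subset hητ
      (hS.Ici_exp_mul_subset hα hβα hI hk hinf (hpos hs _ hinf))).trans hCV
  · have hsupη : sSup νη.support ∈ νη.support := Measure.isClosed_support.csSup_mem
      (Measure.nonempty_support hη.ne_zero) ⟨0, fun z hz ↦ (hnegη hs z hz).le⟩
    refine (Set.union_subset hητ fun y hy ↦ ?_).trans hCV
    have := hSn.Ici_exp_mul_subset hα hβα hI hk (z := -sSup νη.support) (by simpa using hsupη)
      (neg_pos.2 (hnegη hs _ hsupη)) (show _ ≤ -y by rw [mul_neg]; exact neg_le_neg hy)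
    simpa using this
  · obtain ⟨z₁, h₁, hz₁⟩ := KilledExp.exists_mem_support_neg h0η fun h ↦
      hs (hη.isSubordinator (measure_mono_null Set.Iio_subset_Iic_self h))
    obtain ⟨z₂, h₂, hz₂⟩ := KilledExp.exists_mem_support_pos h0η fun h ↦
      hs' (hη.isSubordinator_neg (measure_mono_null Set.Ioi_subset_Ici_self h))
    exact hS.eq_univ_of_Ici (hS.Ici_exp_mul_subset hα hβα hI hk h₂ hz₂) h₁ hz₁
  · refine (Set.union_subset (by simpa using hS.zero_mem) ?_).trans hCV
    exact hS.Ici_subset_of_log hα hαβ hI hsup (hB _ hsup) hl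
  · refine (Set.union_subset (Set.union_subset (by simpa using hS.zero_mem) ?_)
      (hS.Ici_mul_subset hα hαβ hI hk)).trans hCV
    refine Set.iUnion₂_subset fun l hl ↦ ?_
    obtain ⟨n, rfl⟩ := Int.eq_ofNat_of_zero_le (zero_le_one.trans hl.1)
    exact hS.Icc_mul_subset hI (by exact_mod_cast hl.1)
  · refine (Set.union_subset (fun y hy ↦ ?_) (by simpa using hS.zero_mem)).trans hCV
    have := hSn.Ici_subset_of_log (neg_pos.2 hα) (neg_lt_neg hβα) (hIccneg hI) hsup (hB _ hsup)
      (by rwa [neg_div_neg_eq]) (show -α ≤ -y from neg_le_neg hy)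
    simpa using this
  · refine (Set.union_subset (Set.union_subset (fun y hy ↦ ?_) ?_)
      (by simpa using hS.zero_mem)).trans hCV
    · have := hSn.Ici_mul_subset (neg_pos.2 hα) (neg_lt_neg hβα) (hIccneg hI) (hkneg hk)
        (show _ ≤ -y by rw [mul_neg]; exact neg_le_neg hy)
      simpa using this
    · refine Set.iUnion₂_subset fun l hl ↦ ?_
      obtain ⟨n, rfl⟩ := Int.eq_ofNat_of_zero_le (zero_le_one.trans hl.1)
      intro y hy
      have := hSn.Icc_mul_subset (n := n) (hIccneg hI) (by exact_mod_cast hl.1)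
        (show -y ∈ Set.Icc _ _ from
          ⟨by rw [mul_neg]; exact neg_le_neg hy.2, by rw [mul_neg]; exact neg_le_neg hy.1⟩)
      simpa using this
  · obtain ⟨z₁, h₁, hz₁⟩ := KilledExp.exists_mem_support_neg h0η hm
    obtain ⟨z₂, h₂, hz₂⟩ := KilledExp.exists_mem_support_pos h0η hp
    rcases hI with ⟨α, β, hα, hαβ, hI⟩ | ⟨α, β, hβα, hα, hI⟩
    · exact hS.eq_univ_of_Ici (hS.Ici_mul_subset hα hαβ hI rfl) h₁ hz₁
    · exact hneu (hSn.eq_univ_of_Ici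
        (hSn.Ici_mul_subset (neg_pos.2 hα) (neg_lt_neg hβα) (hIccneg hI) rfl)
        (z := -z₂) (by simpa using h₂) (neg_neg_of_pos hz₂))
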